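/- Let $\rho_0,\rho_1$ be density operators (positive semidefinite, trace one) on $\mathbb C^D$. For $t\in[0,1]$ consider the binary channel that sends $\rho_0,\rho_1$ with prior probabilities $1-t$ and $t$, and put $\rho=\rho(t)=(1-t)\rho_0+t\rho_1$ and $\Delta=\rho_1-\rho_0$. A POVM is a finite family $E=(E_b)$ of positive semidefinite operators with $\sum_bE_b=\mathbb 1$; its outcome distributions are $p_k(b)=\mathrm{tr}(\rho_kE_b)$ and $p(b)=\mathrm{tr}(\rho E_b)$. With $H(q)=-\sum_bq(b)\ln q(b)$ (where $0\ln0=0$), let $J_E(t)=H(p)-(1-t)H(p_0)-tH(p_1)$ be the mutual information and let the accessible information $I(t)$ be the maximum of $J_E(t)$ over all POVMs $E$ (this maximum exists). Let $S(\rho)=-\mathrm{tr}(\rho\ln\rho)$ be the von Neumann entropy and $S(t)=S(\rho)-(1-t)S(\rho_0)-tS(\rho_1)$. With an orthonormal eigenbasis $|j\rangle$ of $\rho$ with eigenvalues $\lambda_j$, put $$\mathcal L_\rho(\Delta)=\sum_{j,k:\ \lambda_j+\lambda_k\neq0}\frac{2}{\lambda_j+\lambda_k}\,\langle j|\Delta|k\rangle\,|j\rangle\langle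 k| .$$ Then: (a) For $0<t<1$ the operator $\mathcal L_\rho(\Delta)$ is Hermitian and satisfies $\tfrac12\bigl(\rho\,\mathcal L_\rho(\Delta)+\mathcal L_\rho(\Delta)\,\rho\bigr)=\Delta$. (b) For every POVM $E$ the function $J_E$ is twice continuously differentiable on $(0,1)$, and for $0<t<1$ $$\min_E J_E''(t)=-\mathrm{tr}\bigl(\Delta\,\mathcal L_\rho(\Delta)\bigr),$$ the minimum being attained by the projectors $E_b=|b\rangle\langle b|$ onto any orthonormal eigenbasis $(|b\rangle)$ of $\mathcal L_\rho(\Delta)$. (c) There is exactly one continuous function $L:[0,1]\to\mathbb R$ that is twice differentiable on $(0,1)$ with $L''(t)=-\mathrm{tr}\bigl(\Delta\,\mathcal L_{\rho(t)}(\Delta)\bigr)$ there and with $L(0)=L(1)=0$; and for all $t\in[0,1]$ $$I(t)\le L(t)\le S(t)=S(\rho)-(1-t)S(\rho_0)-tS(\rho_1).$$ (d) For $0<t<1$, $I(t)=S(t)$ if and only if $\rho_0$ and $\rho_1$ commute. -/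

import Mathlib

open scoped Matrix ComplexOrder

noncomputable section

namespace BinaryChannel

variable {n : Type*} [Fintype n]

/-- A density operator on the `D`-dimensional Hilbert space `ℂ^n`, `D = card n`. -/
structure DensityOperator (n : Type*) [Fintype n] where
  op : Matrix n n ℂ
  posSemidef : op.PosSemidef
  trace_eq_one : op.trace = 1

/-- The mean operator `ρ(t) = (1 - t) ρ₀ + t ρ₁` of the channel with priors `1 - t` and `t`. -/
def mean (ρ₀ ρ₁ : DensityOperator n) (t : ℝ) : Matrix n n ℂ :=
  ((1 - t : ℝ) : ℂ) • ρ₀.op + (t : ℂ) • ρ₁.op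

/-- The difference operator `Δ = ρ₁ - ρ₀`. -/
def diff (ρ₀ ρ₁ : DensityOperator n) : Matrix n n ℂ := ρ₁.op - ρ₀.op

theorem mean_isHermitian (ρ₀ ρ₁ : DensityOperator n) (t : ℝ) : (mean ρ₀ ρ₁ t).IsHermitian := by
  have h₀ := ρ₀.posSemidef.isHermitian.eq
  have h₁ := ρ₁.posSemidef.isHermitian.eq
  simp [mean, Matrix.IsHermitian, Matrix.conjTranspose_add, Matrix.conjTranspose_smul, h₀, h₁]

variable [DecidableEq n]

/-- A measurement (POVM) with outcomes `b : ι`: positive operators that sum to the identity. -/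
structure IsPOVM {ι : Type*} [Fintype ι] (E : ι → Matrix n n ℂ) : Prop where
  posSemidef : ∀ b, (E b).PosSemidef
  sum_eq_one : ∑ b, E b = 1

/-- The probability `tr(ρ E)` of an outcome with operator `E` in the state `ρ`. -/
def prob (ρ E : Matrix n n ℂ) : ℝ := (ρ * E).trace.re

/-- Shannon information `H(q) = -∑_b q(b) ln q(b)`, in nats. -/
def shannon {ι : Type*} [Fintype ι] (q : ι → ℝ) : ℝ := ∑ b, Real.negMulLog (q b)

/-- The mutual information `J(t) = H(p) - (1 - t) H(p₀) - t H(p₁)` of the channel with respect to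
the measurement `E`. -/
def mutualInfo (ρ₀ ρ₁ : DensityOperator n) {ι : Type*} [Fintype ι] (E : ι → Matrix n n ℂ)
    (t : ℝ) : ℝ :=
  shannon (fun b => prob (mean ρ₀ ρ₁ t) (E b))
    - (1 - t) * shannon (fun b => prob ρ₀.op (E b))
    - t * shannon (fun b => prob ρ₁.op (E b))

/-- All values that the mutual information takes on measurements with finitely many outcomes. -/
def mutualInfoValues (ρ₀ ρ₁ : DensityOperator n) (t : ℝ) : Set ℝ :=
  {x | ∃ (N : ℕ) (E : Fin N → Matrix n n ℂ), IsPOVM E ∧ mutualInfo ρ₀ ρ₁ E t = x}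

/-- The accessible information `I(t)`. -/
def accessibleInfo (ρ₀ ρ₁ : DensityOperator n) (t : ℝ) : ℝ :=
  sSup (mutualInfoValues ρ₀ ρ₁ t)

/-- The values at `t` of the second derivatives `J''` over all measurements. -/
def mutualInfoSecondDerivValues (ρ₀ ρ₁ : DensityOperator n) (t : ℝ) : Set ℝ :=
  {x | ∃ (N : ℕ) (E : Fin N → Matrix n n ℂ),
    IsPOVM E ∧ iteratedDeriv 2 (mutualInfo ρ₀ ρ₁ E) t = x}

/-- Von Neumann entropy `S(ρ) = -tr(ρ ln ρ) = -∑_j λ_j ln λ_j`, with `λ_j` the eigenvalues. -/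
def vonNeumannEntropy {ρ : Matrix n n ℂ} (hρ : ρ.IsHermitian) : ℝ :=
  ∑ j, Real.negMulLog (hρ.eigenvalues j)

/-- The Holevo quantity `S(t) = S(ρ) - (1 - t) S(ρ₀) - t S(ρ₁)`. -/
def holevo (ρ₀ ρ₁ : DensityOperator n) (t : ℝ) : ℝ :=
  vonNeumannEntropy (mean_isHermitian ρ₀ ρ₁ t)
    - (1 - t) * vonNeumannEntropy ρ₀.posSemidef.isHermitian
    - t * vonNeumannEntropy ρ₁.posSemidef.isHermitian

/-- The operator `𝓛_ρ(A) = ∑_{λ_j + λ_k ≠ 0} 2 / (λ_j + λ_k) ⟨j|A|k⟩ |j⟩⟨k|`, where `|j⟩` is an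
orthonormal eigenbasis of `ρ` with eigenvalues `λ_j`. -/
def lowering {ρ : Matrix n n ℂ} (hρ : ρ.IsHermitian) (A : Matrix n n ℂ) : Matrix n n ℂ :=
  let ket : n → n → ℂ := fun j => (hρ.eigenvectorBasis j).ofLp
  ∑ j, ∑ k, if hρ.eigenvalues j + hρ.eigenvalues k = 0 then 0 else
    (2 / ((hρ.eigenvalues j : ℂ) + (hρ.eigenvalues k : ℂ)) * (star (ket j) ⬝ᵥ (A *ᵥ ket k))) •
      Matrix.vecMulVec (ket j) (star (ket k))

/-- The operator `𝓛_{ρ(t)}(Δ)`. -/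
def loweredDiff (ρ₀ ρ₁ : DensityOperator n) (t : ℝ) : Matrix n n ℂ :=
  lowering (mean_isHermitian ρ₀ ρ₁ t) (diff ρ₀ ρ₁)

/-- The curvature `-tr(Δ 𝓛_{ρ(t)}(Δ))` prescribed for the bound `L` at `0 < t < 1`. -/
def curvature (ρ₀ ρ₁ : DensityOperator n) (t : ℝ) : ℝ :=
  -(diff ρ₀ ρ₁ * loweredDiff ρ₀ ρ₁ t).trace.re

/-- `L` is a function on `[0,1]` with `L'' = -tr(Δ 𝓛_ρ(Δ))` inside and `L(0) = L(1) = 0`.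
Continuity up to the end points ties the boundary values to the interior. -/
structure IsCurvatureBound (ρ₀ ρ₁ : DensityOperator n) (L : ℝ → ℝ) : Prop where
  continuousOn : ContinuousOn L (Set.Icc 0 1)
  zero : L 0 = 0
  one : L 1 = 0
  differentiableAt : ∀ t ∈ Set.Ioo (0 : ℝ) 1, DifferentiableAt ℝ L t
  hasDerivAt_deriv : ∀ t ∈ Set.Ioo (0 : ℝ) 1,
    HasDerivAt (deriv L) (curvature ρ₀ ρ₁ t) t

/-- The orthonormal basis `v` consists of eigenvectors of `A`. -/
def IsEigenbasis (v : OrthonormalBasis n ℂ (EuclideanSpace ℂ n)) (A : Matrix n n ℂ) : Prop :=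
  ∀ b, ∃ μ : ℂ, A *ᵥ (v b).ofLp = μ • (v b).ofLp

/-- The measurement in the basis `v`: the projectors `|b⟩⟨b|`. -/
def basisMeasurement (v : OrthonormalBasis n ℂ (EuclideanSpace ℂ n)) (b : n) : Matrix n n ℂ :=
  Matrix.vecMulVec (v b).ofLp (star (v b).ofLp)

end BinaryChannel

end

namespace BinaryChannel

/-! Each inequality compares second derivatives on (0,1) and uses that a concave function with
nonnegative end values is nonnegative.

For a POVM E, J_E'' = -∑ tr(ΔE_b)²/tr(ρE_b). With 𝓛 = 𝓛_ρ(Δ), the equation ρ𝓛 + 𝓛ρ = 2Δ gives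
tr(ΔE_b) = Re tr(ρ𝓛E_b), and Cauchy–Schwarz bounds each quotient by tr(𝓛ρ𝓛E_b)
(`prob_diff_sq_div_le`); these sum to tr(Δ𝓛). Eigenprojectors of 𝓛 give equality
(`sum_prob_sq_div_eigenbasis`). So L - J_E is concave and vanishes at 0 and 1, whence I ≤ L. For the
existence of L, the curvature is continuous, being an infimum of affine functions of t, and
O(1/(t(1-t))); hence its primitive has at most logarithmic singularities and can be integrated again
(`exists_second_primitive`).

For L ≤ S, the entropy is replaced by truncations of -x ln x = ∑ x(1-x)^(k+1)/(k+1), polynomials in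
ρ that can be differentiated without perturbation theory. In an eigenbasis of ρ their second
derivative has coefficients built from complete homogeneous polynomials h_k(1-λ_a, 1-λ_b). Since
h_k/(k+1) dominates the k-th power of the mean (`pow_mean_le_completeHom`), a geometric series
recovers the coefficient 2/(λ_a+λ_b) of the curvature. The surplus at k = 2 sums to ‖[ρ₀,ρ₁]‖²/12,
so S - L ≥ ‖[ρ₀,ρ₁]‖² t(1-t)/24 (`IsCurvatureBound.add_commutatorSq_le_holevo`). Thus I = S forces
commutation; conversely, measuring in a common eigenbasis attains S. -/

/-- Conjugation by the unitary that diagonalises the Hermitian matrix `ρ`. -/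
noncomputable def toEigen {n : Type*} [Fintype n] [DecidableEq n] {ρ : Matrix n n ℂ}
    (hρ : ρ.IsHermitian) : Matrix n n ℂ ≃⋆ₐ[ℂ] Matrix n n ℂ :=
  Unitary.conjStarAlgAut ℂ _ (star hρ.eigenvectorUnitary)

/-! ### Matrices in the eigenbasis of a Hermitian matrix -/

section Spectral

variable {n : Type*} [Fintype n] [DecidableEq n] {ρ : Matrix n n ℂ}

theorem toEigen_apply (hρ : ρ.IsHermitian) (A : Matrix n n ℂ) :
    toEigen hρ A = (hρ.eigenvectorUnitary : Matrix n n ℂ)ᴴ * A * hρ.eigenvectorUnitary := by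
  rw [toEigen, Unitary.conjStarAlgAut_star_apply]; rfl

theorem toEigen_injective (hρ : ρ.IsHermitian) : Function.Injective (toEigen hρ) :=
  EquivLike.injective _

theorem toEigen_self (hρ : ρ.IsHermitian) :
    toEigen hρ ρ = Matrix.diagonal (fun j => (hρ.eigenvalues j : ℂ)) :=
  hρ.conjStarAlgAut_star_eigenvectorUnitary

theorem trace_toEigen (hρ : ρ.IsHermitian) (A : Matrix n n ℂ) :
    (toEigen hρ A).trace = A.trace := by
  rw [toEigen_apply, Matrix.trace_mul_cycle, ← Matrix.star_eq_conjTranspose]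
  simp

theorem toEigen_isHermitian (hρ : ρ.IsHermitian) {A : Matrix n n ℂ} (hA : A.IsHermitian) :
    (toEigen hρ A).IsHermitian := by
  rw [Matrix.IsHermitian, ← Matrix.star_eq_conjTranspose, ← map_star,
    Matrix.star_eq_conjTranspose, hA.eq]

theorem toEigen_posSemidef (hρ : ρ.IsHermitian) {A : Matrix n n ℂ} (hA : A.PosSemidef) :
    (toEigen hρ A).PosSemidef := by
  rw [toEigen_apply]
  exact hA.conjTranspose_mul_mul_same _

theorem toEigen_apply_apply (hρ : ρ.IsHermitian) (A : Matrix n n ℂ) (j k : n) :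
    toEigen hρ A j k =
      star (hρ.eigenvectorBasis j).ofLp ⬝ᵥ (A *ᵥ (hρ.eigenvectorBasis k).ofLp) := by
  rw [toEigen_apply, Matrix.mul_assoc, Matrix.mul_apply]
  simp [dotProduct, Matrix.mulVec, Matrix.mul_apply]

/-- In the eigenbasis the operator is an entrywise multiplier; the convention 2/0 = 0 absorbs the
case distinction in the sum. -/
theorem toEigen_lowering (hρ : ρ.IsHermitian) (A : Matrix n n ℂ) :
    toEigen hρ (lowering hρ A) = Matrix.of fun j k =>
      ((2 / (hρ.eigenvalues j + hρ.eigenvalues k) : ℝ) : ℂ) * toEigen hρ A j k := by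
  rw [← StarAlgEquiv.eq_symm_apply, toEigen, Unitary.conjStarAlgAut_symm, star_star,
    Unitary.conjStarAlgAut_apply]
  ext i l
  rw [Matrix.mul_assoc, Matrix.mul_apply]
  simp only [lowering, Matrix.sum_apply, Matrix.mul_apply, Finset.mul_sum]
  refine Finset.sum_congr rfl fun j _ => Finset.sum_congr rfl fun k _ => ?_
  have h := toEigen_apply_apply hρ A j k
  rw [toEigen] at h
  rw [Matrix.of_apply, h]
  split_ifs with h0
  · simp [h0]
  · simp only [Matrix.smul_apply, Matrix.vecMulVec_apply, smul_eq_mul,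
      Matrix.IsHermitian.eigenvectorUnitary_apply, Matrix.star_apply, Pi.star_apply]
    push_cast
    ring

end Spectral

/-! ### Entries of positive semidefinite matrices -/

section Bounds

variable {n : Type*}

/-- This is nonnegativity of the 2×2 minor on the indices a, b; the case a = b needs no exception.
-/
theorem norm_sq_le_of_posSemidef {R : Matrix n n ℂ} (hR : R.PosSemidef) (a b : n) :
    ‖R a b‖ ^ 2 ≤ (R a a).re * (R b b).re := by
  have h := (hR.submatrix ![a, b]).det_nonneg
  have hba : R b a = star (R a b) := (hR.isHermitian.apply b a).symm
  have ha := (Complex.le_def.1 (hR.diag_nonneg (i := a))).2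
  have hb := (Complex.le_def.1 (hR.diag_nonneg (i := b))).2
  rw [Matrix.det_fin_two] at h
  simp only [Matrix.submatrix_apply, Matrix.cons_val_zero, Matrix.cons_val_one, hba] at h
  have h2 := (Complex.le_def.1 h).1
  simp only [Complex.zero_re, Complex.sub_re, Complex.mul_re, Complex.star_def, Complex.conj_re,
    Complex.conj_im, Complex.zero_im] at h2 ha hb
  rw [← Complex.normSq_eq_norm_sq, Complex.normSq_apply]
  rw [← ha, ← hb] at h2
  linarith

theorem diag_re_nonneg {R : Matrix n n ℂ} (hR : R.PosSemidef) (a : n) : 0 ≤ (R a a).re :=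
  (Complex.le_def.1 (hR.diag_nonneg (i := a))).1

theorem diag_re_le_one [Fintype n] {R : Matrix n n ℂ} (hR : R.PosSemidef) (h1 : R.trace = 1) (a : n) :
    (R a a).re ≤ 1 := by
  have h : ∑ b, (R b b).re = 1 := by
    have := congrArg Complex.re h1
    simpa [Matrix.trace] using this
  rw [← h]
  exact Finset.single_le_sum (f := fun b => (R b b).re) (fun b _ => diag_re_nonneg hR b)
    (Finset.mem_univ a)

end Bounds

/-! ### Entries of Δ in the eigenbasis of ρ, and bounds on the curvature -/

section Channel

variable {n : Type*} [Fintype n] (ρ₀ ρ₁ : DensityOperator n)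

theorem diff_isHermitian : (diff ρ₀ ρ₁).IsHermitian :=
  ρ₁.posSemidef.isHermitian.sub ρ₀.posSemidef.isHermitian

theorem mean_posSemidef {t : ℝ} (ht : t ∈ Set.Icc (0 : ℝ) 1) : (mean ρ₀ ρ₁ t).PosSemidef := by
  refine (ρ₀.posSemidef.smul ?_).add (ρ₁.posSemidef.smul ?_)
  · exact Complex.zero_le_real.2 (by linarith [ht.2])
  · exact Complex.zero_le_real.2 ht.1

theorem mean_trace (t : ℝ) : (mean ρ₀ ρ₁ t).trace = 1 := by
  simp [mean, ρ₀.trace_eq_one, ρ₁.trace_eq_one]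

variable [DecidableEq n]

theorem mean_eigenvalues_nonneg {t : ℝ} (ht : t ∈ Set.Icc (0 : ℝ) 1) (a : n) :
    0 ≤ (mean_isHermitian ρ₀ ρ₁ t).eigenvalues a :=
  (mean_posSemidef ρ₀ ρ₁ ht).eigenvalues_nonneg a

theorem mean_eigenvalues_eq (t : ℝ) (a : n) :
    (mean_isHermitian ρ₀ ρ₁ t).eigenvalues a =
      (1 - t) * (toEigen (mean_isHermitian ρ₀ ρ₁ t) ρ₀.op a a).re
        + t * (toEigen (mean_isHermitian ρ₀ ρ₁ t) ρ₁.op a a).re := by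
  have h := congrFun (congrFun (toEigen_self (mean_isHermitian ρ₀ ρ₁ t)) a) a
  rw [Matrix.diagonal_apply_eq] at h
  have h2 := congrArg Complex.re h
  rw [Complex.ofReal_re] at h2
  have h3 : toEigen (mean_isHermitian ρ₀ ρ₁ t) (mean ρ₀ ρ₁ t)
      = ((1 - t : ℝ) : ℂ) • toEigen (mean_isHermitian ρ₀ ρ₁ t) ρ₀.op
        + (t : ℂ) • toEigen (mean_isHermitian ρ₀ ρ₁ t) ρ₁.op := by
    rw [← map_smul, ← map_smul, ← map_add]
    rfl
  rw [← h2, h3]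
  simp only [Matrix.add_apply, Matrix.smul_apply, smul_eq_mul, Complex.add_re,
    Complex.re_ofReal_mul]

/-- The squared moduli of the matrix elements of `Δ` in the eigenbasis of the mean operator. -/
noncomputable def diffEntrySq (t : ℝ) (a b : n) : ℝ :=
  ‖toEigen (mean_isHermitian ρ₀ ρ₁ t) (diff ρ₀ ρ₁) a b‖ ^ 2

theorem diffEntrySq_nonneg (t : ℝ) (a b : n) : 0 ≤ diffEntrySq ρ₀ ρ₁ t a b := sq_nonneg _

theorem toEigen_diff_mul_swap (t : ℝ) (a b : n) :
    toEigen (mean_isHermitian ρ₀ ρ₁ t) (diff ρ₀ ρ₁) a b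
      * toEigen (mean_isHermitian ρ₀ ρ₁ t) (diff ρ₀ ρ₁) b a
      = (diffEntrySq ρ₀ ρ₁ t a b : ℂ) := by
  rw [← (toEigen_isHermitian (mean_isHermitian ρ₀ ρ₁ t) (diff_isHermitian ρ₀ ρ₁)).apply b a,
    Complex.star_def, Complex.mul_conj, Complex.normSq_eq_norm_sq, diffEntrySq]

theorem diffEntrySq_le_of_entry_le {t : ℝ} {a b : n} {x y : ℝ}
    (hx : ‖toEigen (mean_isHermitian ρ₀ ρ₁ t) ρ₀.op a b‖ ^ 2 ≤ x)
    (hy : ‖toEigen (mean_isHermitian ρ₀ ρ₁ t) ρ₁.op a b‖ ^ 2 ≤ y) :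
    diffEntrySq ρ₀ ρ₁ t a b ≤ 2 * (x + y) := by
  rw [diffEntrySq, diff, map_sub, Matrix.sub_apply]
  set z := toEigen (mean_isHermitian ρ₀ ρ₁ t) ρ₀.op a b
  set w := toEigen (mean_isHermitian ρ₀ ρ₁ t) ρ₁.op a b
  have h := norm_sub_le w z
  have h0 := norm_nonneg (w - z)
  nlinarith [sq_nonneg (‖w‖ - ‖z‖)]

/-- Each diagonal entry of ρ₀ is at most λ/(1-t) and each one of ρ₁ at most λ/t, and these control
the off-diagonal entries. The product form is what later tames the tail of the truncated entropy. -/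
theorem diffEntrySq_le_mul {t : ℝ} (ht : t ∈ Set.Ioo (0 : ℝ) 1) (a b : n) :
    diffEntrySq ρ₀ ρ₁ t a b ≤ 2 * (((1 - t) ^ 2)⁻¹ + (t ^ 2)⁻¹) *
      ((mean_isHermitian ρ₀ ρ₁ t).eigenvalues a * (mean_isHermitian ρ₀ ρ₁ t).eigenvalues b) := by
  have hR0 := toEigen_posSemidef (mean_isHermitian ρ₀ ρ₁ t) ρ₀.posSemidef
  have hR1 := toEigen_posSemidef (mean_isHermitian ρ₀ ρ₁ t) ρ₁.posSemidef
  have ha := mean_eigenvalues_eq ρ₀ ρ₁ t a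
  have hb := mean_eigenvalues_eq ρ₀ ρ₁ t b
  have h0 := norm_sq_le_of_posSemidef hR0 a b
  have h1 := norm_sq_le_of_posSemidef hR1 a b
  have p0a := diag_re_nonneg hR0 a
  have p0b := diag_re_nonneg hR0 b
  have p1a := diag_re_nonneg hR1 a
  have p1b := diag_re_nonneg hR1 b
  obtain ⟨ht0, ht1⟩ := ht
  have ht1' : 0 < 1 - t := by linarith
  rw [mul_assoc, add_mul]
  have key : ∀ s x y u v c d : ℝ, 0 < s → 0 ≤ x → 0 ≤ y → 0 ≤ c → 0 ≤ d → u = s * x + c →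
      v = s * y + d → x * y ≤ (s ^ 2)⁻¹ * (u * v) := by
    intro s x y u v c d hs hx hy hc hd hu hv
    rw [inv_mul_eq_div, le_div_iff₀ (by positivity), hu, hv]
    nlinarith [mul_nonneg (mul_nonneg hs.le hx) hd, mul_nonneg (mul_nonneg hs.le hy) hc,
      mul_nonneg hc hd]
  refine diffEntrySq_le_of_entry_le ρ₀ ρ₁ (h0.trans ?_) (h1.trans ?_)
  · exact key _ _ _ _ _ _ _ ht1' p0a p0b (mul_nonneg ht0.le p1a) (mul_nonneg ht0.le p1b) ha hb
  · exact key _ _ _ _ _ _ _ ht0 p1a p1b (mul_nonneg ht1'.le p0a) (mul_nonneg ht1'.le p0b)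
      (ha.trans (add_comm _ _)) (hb.trans (add_comm _ _))

/-- Uses xy ≤ (x+y)/2 for diagonal entries x, y in [0,1], then 1/(1-t) + 1/t = 1/(t(1-t)). It makes
Δ vanish wherever λ_a + λ_b = 0 and bounds the curvature near the end points. -/
theorem diffEntrySq_le_add {t : ℝ} (ht : t ∈ Set.Ioo (0 : ℝ) 1) (a b : n) :
    diffEntrySq ρ₀ ρ₁ t a b ≤ (t * (1 - t))⁻¹ *
      ((mean_isHermitian ρ₀ ρ₁ t).eigenvalues a + (mean_isHermitian ρ₀ ρ₁ t).eigenvalues b) := by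
  have hR0 := toEigen_posSemidef (mean_isHermitian ρ₀ ρ₁ t) ρ₀.posSemidef
  have hR1 := toEigen_posSemidef (mean_isHermitian ρ₀ ρ₁ t) ρ₁.posSemidef
  have hT0 := (trace_toEigen (mean_isHermitian ρ₀ ρ₁ t) ρ₀.op).trans ρ₀.trace_eq_one
  have hT1 := (trace_toEigen (mean_isHermitian ρ₀ ρ₁ t) ρ₁.op).trans ρ₁.trace_eq_one
  have ha := mean_eigenvalues_eq ρ₀ ρ₁ t a
  have hb := mean_eigenvalues_eq ρ₀ ρ₁ t b
  have h0 := norm_sq_le_of_posSemidef hR0 a b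
  have h1 := norm_sq_le_of_posSemidef hR1 a b
  have p0a := diag_re_nonneg hR0 a
  have p0b := diag_re_nonneg hR0 b
  have p1a := diag_re_nonneg hR1 a
  have p1b := diag_re_nonneg hR1 b
  have q0a := diag_re_le_one hR0 hT0 a
  have q0b := diag_re_le_one hR0 hT0 b
  have q1a := diag_re_le_one hR1 hT1 a
  have q1b := diag_re_le_one hR1 hT1 b
  obtain ⟨ht0, ht1⟩ := ht
  have ht1' : 0 < 1 - t := by linarith
  have key : ∀ s x y u v c d : ℝ, 0 < s → 0 ≤ x → 0 ≤ y → x ≤ 1 → y ≤ 1 → 0 ≤ c → 0 ≤ d →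
      u = s * x + c → v = s * y + d → x * y ≤ (2 * s)⁻¹ * (u + v) := by
    intro s x y u v c d hs hx hy hx1 hy1 hc hd hu hv
    rw [inv_mul_eq_div, le_div_iff₀ (by positivity), hu, hv]
    nlinarith [mul_nonneg (mul_nonneg hs.le hx) (sub_nonneg.2 hy1),
      mul_nonneg (mul_nonneg hs.le hy) (sub_nonneg.2 hx1)]
  refine (diffEntrySq_le_of_entry_le ρ₀ ρ₁ (h0.trans ?_) (h1.trans ?_)).trans_eq
    (b := 2 * ((2 * (1 - t))⁻¹ * ((mean_isHermitian ρ₀ ρ₁ t).eigenvalues a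
      + (mean_isHermitian ρ₀ ρ₁ t).eigenvalues b) + (2 * t)⁻¹ *
      ((mean_isHermitian ρ₀ ρ₁ t).eigenvalues a + (mean_isHermitian ρ₀ ρ₁ t).eigenvalues b))) ?_
  · exact key _ _ _ _ _ _ _ ht1' p0a p0b q0a q0b (mul_nonneg ht0.le p1a) (mul_nonneg ht0.le p1b)
      ha hb
  · exact key _ _ _ _ _ _ _ ht0 p1a p1b q1a q1b (mul_nonneg ht1'.le p0a) (mul_nonneg ht1'.le p0b)
      (ha.trans (add_comm _ _)) (hb.trans (add_comm _ _))
  · field_simp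
    ring

theorem toEigen_diff_eq_zero {t : ℝ} (ht : t ∈ Set.Ioo (0 : ℝ) 1) {a b : n}
    (hab : (mean_isHermitian ρ₀ ρ₁ t).eigenvalues a
      + (mean_isHermitian ρ₀ ρ₁ t).eigenvalues b = 0) :
    toEigen (mean_isHermitian ρ₀ ρ₁ t) (diff ρ₀ ρ₁) a b = 0 := by
  have h := diffEntrySq_le_add ρ₀ ρ₁ ht a b
  rw [hab, mul_zero] at h
  have h2 := le_antisymm h (diffEntrySq_nonneg ρ₀ ρ₁ t a b)
  simpa [diffEntrySq] using h2

theorem loweredDiff_isHermitian (t : ℝ) : (loweredDiff ρ₀ ρ₁ t).IsHermitian := by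
  have h : (toEigen (mean_isHermitian ρ₀ ρ₁ t) (loweredDiff ρ₀ ρ₁ t)).IsHermitian := by
    rw [loweredDiff, toEigen_lowering]
    ext a b
    have hD := toEigen_isHermitian (mean_isHermitian ρ₀ ρ₁ t) (diff_isHermitian ρ₀ ρ₁)
    simp only [Matrix.conjTranspose_apply, Matrix.of_apply, star_mul', hD.apply]
    rw [add_comm, Complex.star_def, Complex.conj_ofReal]
  apply toEigen_injective (mean_isHermitian ρ₀ ρ₁ t)
  rw [← Matrix.star_eq_conjTranspose, map_star, Matrix.star_eq_conjTranspose, h.eq]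

/-- Entrywise, λ_a + λ_b cancels the denominator; where that sum is zero, the entry of Δ is zero
too. -/
theorem mean_mul_loweredDiff_add {t : ℝ} (ht : t ∈ Set.Ioo (0 : ℝ) 1) :
    mean ρ₀ ρ₁ t * loweredDiff ρ₀ ρ₁ t + loweredDiff ρ₀ ρ₁ t * mean ρ₀ ρ₁ t
      = (2 : ℂ) • diff ρ₀ ρ₁ := by
  apply toEigen_injective (mean_isHermitian ρ₀ ρ₁ t)
  rw [map_add, map_mul, map_mul, map_smul, toEigen_self, loweredDiff, toEigen_lowering]
  ext a b
  simp only [Matrix.add_apply, Matrix.diagonal_mul, Matrix.mul_diagonal, Matrix.of_apply,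
    Matrix.smul_apply, smul_eq_mul]
  by_cases hab : (mean_isHermitian ρ₀ ρ₁ t).eigenvalues a
      + (mean_isHermitian ρ₀ ρ₁ t).eigenvalues b = 0
  · rw [toEigen_diff_eq_zero ρ₀ ρ₁ ht hab]
    simp
  · have hab' : ((mean_isHermitian ρ₀ ρ₁ t).eigenvalues a : ℂ)
      + (mean_isHermitian ρ₀ ρ₁ t).eigenvalues b ≠ 0 := by exact_mod_cast hab
    push_cast
    field_simp

theorem curvature_eq (t : ℝ) :
    curvature ρ₀ ρ₁ t = -∑ a, ∑ b, 2 / ((mean_isHermitian ρ₀ ρ₁ t).eigenvalues a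
      + (mean_isHermitian ρ₀ ρ₁ t).eigenvalues b) * diffEntrySq ρ₀ ρ₁ t a b := by
  rw [curvature, ← trace_toEigen (mean_isHermitian ρ₀ ρ₁ t), map_mul, loweredDiff,
    toEigen_lowering]
  have h : ∀ a b : n, toEigen (mean_isHermitian ρ₀ ρ₁ t) (diff ρ₀ ρ₁) a b *
      (((2 / ((mean_isHermitian ρ₀ ρ₁ t).eigenvalues b
        + (mean_isHermitian ρ₀ ρ₁ t).eigenvalues a) : ℝ) : ℂ) *
        toEigen (mean_isHermitian ρ₀ ρ₁ t) (diff ρ₀ ρ₁) b a)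
      = ((2 / ((mean_isHermitian ρ₀ ρ₁ t).eigenvalues a
        + (mean_isHermitian ρ₀ ρ₁ t).eigenvalues b) * diffEntrySq ρ₀ ρ₁ t a b : ℝ) : ℂ) := by
    intro a b
    rw [mul_left_comm, toEigen_diff_mul_swap, Complex.ofReal_mul, add_comm]
  simp only [Matrix.trace, Matrix.diag, Matrix.mul_apply, Matrix.of_apply, h]
  rw [← Complex.ofReal_re (∑ a, ∑ b, _)]
  push_cast
  rfl

theorem curvature_nonpos {t : ℝ} (ht : t ∈ Set.Icc (0 : ℝ) 1) : curvature ρ₀ ρ₁ t ≤ 0 := by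
  rw [curvature_eq, neg_nonpos]
  refine Finset.sum_nonneg fun a _ => Finset.sum_nonneg fun b _ => ?_
  have ha := mean_eigenvalues_nonneg ρ₀ ρ₁ ht a
  have hb := mean_eigenvalues_nonneg ρ₀ ρ₁ ht b
  have := diffEntrySq_nonneg ρ₀ ρ₁ t a b
  positivity

/-- Each of the (card n)² terms is at most 2/(t(1-t)). This growth is slow enough for the first
primitive to be integrable. -/
theorem neg_le_curvature {t : ℝ} (ht : t ∈ Set.Ioo (0 : ℝ) 1) :
    -(2 * (Fintype.card n : ℝ) ^ 2 / (t * (1 - t))) ≤ curvature ρ₀ ρ₁ t := by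
  rw [curvature_eq, neg_le_neg_iff]
  have h : ∀ a b : n, 2 / ((mean_isHermitian ρ₀ ρ₁ t).eigenvalues a
      + (mean_isHermitian ρ₀ ρ₁ t).eigenvalues b) * diffEntrySq ρ₀ ρ₁ t a b
      ≤ 2 / (t * (1 - t)) := by
    intro a b
    have ha := mean_eigenvalues_nonneg ρ₀ ρ₁ (Set.Ioo_subset_Icc_self ht) a
    have hb := mean_eigenvalues_nonneg ρ₀ ρ₁ (Set.Ioo_subset_Icc_self ht) b
    have hD := diffEntrySq_le_add ρ₀ ρ₁ ht a b
    have htt : 0 < t * (1 - t) := mul_pos ht.1 (sub_pos.2 ht.2)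
    rcases (add_nonneg ha hb).eq_or_lt with h0 | h0
    · rw [← h0, div_zero, zero_mul]
      positivity
    · calc _ ≤ 2 / ((mean_isHermitian ρ₀ ρ₁ t).eigenvalues a
          + (mean_isHermitian ρ₀ ρ₁ t).eigenvalues b) * ((t * (1 - t))⁻¹ *
          ((mean_isHermitian ρ₀ ρ₁ t).eigenvalues a
            + (mean_isHermitian ρ₀ ρ₁ t).eigenvalues b)) :=
            mul_le_mul_of_nonneg_left hD (by positivity)
        _ = 2 / (t * (1 - t)) := by
            field_simp
  calc _ ≤ ∑ _a : n, ∑ _b : n, 2 / (t * (1 - t)) :=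
        Finset.sum_le_sum fun a _ => Finset.sum_le_sum fun b _ => h a b
    _ = _ := by
        simp only [Finset.sum_const, Finset.card_univ, nsmul_eq_mul]
        ring

end Channel

/-! ### The information of a single outcome as a function of t -/

section Scalar

/-- The contribution to the mutual information of an outcome with probabilities `p` and `q`. -/
noncomputable def outcomeInfo (p q t : ℝ) : ℝ :=
  Real.negMulLog ((1 - t) * p + t * q) - (1 - t) * Real.negMulLog p - t * Real.negMulLog q

theorem outcomeInfo_zero (p q : ℝ) : outcomeInfo p q 0 = 0 := by simp [outcomeInfo]

theorem outcomeInfo_one (p q : ℝ) : outcomeInfo p q 1 = 0 := by simp [outcomeInfo]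

theorem continuous_outcomeInfo :
    Continuous fun x : ℝ × ℝ × ℝ => outcomeInfo x.1 x.2.1 x.2.2 := by
  unfold outcomeInfo
  fun_prop

/-- The terms containing ln c are linear in the probabilities and cancel. This homogeneity allows
effects to be normalised to trace one. -/
theorem outcomeInfo_mul (c p q t : ℝ) : outcomeInfo (c * p) (c * q) t = c * outcomeInfo p q t := by
  have h : (1 - t) * (c * p) + t * (c * q) = c * ((1 - t) * p + t * q) := by ring
  rw [outcomeInfo, outcomeInfo, h, Real.negMulLog_mul, Real.negMulLog_mul, Real.negMulLog_mul]
  ring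

/-- The derivative of `outcomeInfo p q`. -/
noncomputable def outcomeInfoDeriv (p q t : ℝ) : ℝ :=
  (q - p) * (-Real.log ((1 - t) * p + t * q) - 1) + Real.negMulLog p - Real.negMulLog q

/-- An outcome impossible for both states contributes nothing; any other has positive probability
throughout (0,1), away from the singularity of x ln x. -/
theorem mixture_pos_or_zero {p q t : ℝ} (hp : 0 ≤ p) (hq : 0 ≤ q) (ht : t ∈ Set.Ioo (0 : ℝ) 1) :
    (p = 0 ∧ q = 0) ∨ 0 < (1 - t) * p + t * q := by
  have h1 : 0 < 1 - t := by linarith [ht.2]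
  rcases hp.eq_or_lt with rfl | hp
  · rcases hq.eq_or_lt with rfl | hq
    · exact Or.inl ⟨rfl, rfl⟩
    · right
      have := mul_pos ht.1 hq
      linarith
  · right
    have := mul_pos h1 hp
    have := mul_nonneg ht.1.le hq
    linarith

theorem hasDerivAt_mixture (p q t : ℝ) :
    HasDerivAt (fun s : ℝ => (1 - s) * p + s * q) (q - p) t := by
  have h : HasDerivAt (fun s : ℝ => (1 - s) * p + s * q) (-1 * p + 1 * q) t :=
    (((hasDerivAt_id t).const_sub 1).mul_const p).add ((hasDerivAt_id t).mul_const q)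
  exact h.congr_deriv (by ring)

theorem hasDerivAt_outcomeInfo {p q t : ℝ} (hp : 0 ≤ p) (hq : 0 ≤ q) (ht : t ∈ Set.Ioo (0 : ℝ) 1) :
    HasDerivAt (outcomeInfo p q) (outcomeInfoDeriv p q t) t := by
  rcases mixture_pos_or_zero hp hq ht with ⟨rfl, rfl⟩ | h
  · have h0 : outcomeInfo 0 0 = fun _ => 0 := by ext; simp [outcomeInfo]
    simpa [h0, outcomeInfoDeriv] using hasDerivAt_const t (0 : ℝ)
  · have h1 := (Real.hasDerivAt_negMulLog h.ne').comp t (hasDerivAt_mixture p q t)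
    have h2 := (h1.sub (((hasDerivAt_id t).const_sub 1).mul_const (Real.negMulLog p))).sub
      ((hasDerivAt_id t).mul_const (Real.negMulLog q))
    refine h2.congr_deriv ?_
    simp only [outcomeInfoDeriv]
    ring

theorem hasDerivAt_outcomeInfoDeriv {p q t : ℝ} (hp : 0 ≤ p) (hq : 0 ≤ q)
    (ht : t ∈ Set.Ioo (0 : ℝ) 1) :
    HasDerivAt (outcomeInfoDeriv p q) (-((q - p) ^ 2 / ((1 - t) * p + t * q))) t := by
  rcases mixture_pos_or_zero hp hq ht with ⟨rfl, rfl⟩ | h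
  · have h0 : outcomeInfoDeriv 0 0 = fun _ => 0 := by ext; simp [outcomeInfoDeriv]
    simpa [h0] using hasDerivAt_const t (0 : ℝ)
  · have h1 := ((((hasDerivAt_mixture p q t).log h.ne').neg.sub_const 1).const_mul
      (q - p)).add_const (Real.negMulLog p) |>.sub_const (Real.negMulLog q)
    refine h1.congr_deriv ?_
    ring

theorem contDiffAt_outcomeInfo {p q t : ℝ} (hp : 0 ≤ p) (hq : 0 ≤ q)
    (ht : t ∈ Set.Ioo (0 : ℝ) 1) : ContDiffAt ℝ 2 (outcomeInfo p q) t := by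
  rcases mixture_pos_or_zero hp hq ht with ⟨rfl, rfl⟩ | h
  · have h0 : outcomeInfo 0 0 = fun _ => 0 := by ext; simp [outcomeInfo]
    rw [h0]
    exact contDiffAt_const
  · have hlin : ContDiffAt ℝ 2 (fun s : ℝ => (1 - s) * p + s * q) t := by fun_prop
    have hm : ContDiffAt ℝ 2 (fun s : ℝ => Real.negMulLog ((1 - s) * p + s * q)) t :=
      hlin.neg.mul (hlin.log h.ne')
    unfold outcomeInfo
    fun_prop

end Scalar

/-! ### The second derivative of the mutual information and its lower bound -/

section Measurement

variable {n ι : Type*} [Fintype n]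

theorem trace_mul_vecMulVec (A : Matrix n n ℂ) (v w : n → ℂ) :
    (A * Matrix.vecMulVec v w).trace = w ⬝ᵥ (A *ᵥ v) := by
  rw [Matrix.mul_vecMulVec, Matrix.trace_vecMulVec, dotProduct_comm]

theorem prob_nonneg {A B : Matrix n n ℂ} (hA : A.PosSemidef) (hB : B.PosSemidef) :
    0 ≤ prob A B := by
  obtain ⟨m, v, rfl⟩ := Matrix.posSemidef_iff_eq_sum_vecMulVec.1 hB
  rw [prob, Finset.mul_sum, Matrix.trace_sum, Complex.re_sum]
  refine Finset.sum_nonneg fun i _ => ?_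
  rw [trace_mul_vecMulVec]
  exact hA.re_dotProduct_nonneg (v i)

theorem trace_mul_im_eq_zero {A B : Matrix n n ℂ} (hA : A.IsHermitian) (hB : B.IsHermitian) :
    (A * B).trace.im = 0 := by
  have h := Matrix.trace_conjTranspose (A * B)
  rw [Matrix.conjTranspose_mul, hA.eq, hB.eq, Matrix.trace_mul_comm] at h
  exact Complex.conj_eq_iff_im.1 h.symm

variable (ρ₀ ρ₁ : DensityOperator n)

theorem prob_mean (E : Matrix n n ℂ) (t : ℝ) :
    prob (mean ρ₀ ρ₁ t) E = (1 - t) * prob ρ₀.op E + t * prob ρ₁.op E := by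
  simp only [prob, mean, Matrix.add_mul, Matrix.smul_mul, Matrix.trace_add, Matrix.trace_smul,
    smul_eq_mul, Complex.add_re, Complex.re_ofReal_mul]

theorem prob_diff (E : Matrix n n ℂ) :
    prob (diff ρ₀ ρ₁) E = prob ρ₁.op E - prob ρ₀.op E := by
  simp only [prob, diff, Matrix.sub_mul, Matrix.trace_sub, Complex.sub_re]

variable [Fintype ι]

theorem mutualInfo_eq_sum (E : ι → Matrix n n ℂ) :
    mutualInfo ρ₀ ρ₁ E = fun t => ∑ b, outcomeInfo (prob ρ₀.op (E b)) (prob ρ₁.op (E b)) t := by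
  ext t
  simp only [mutualInfo, shannon, prob_mean, outcomeInfo, Finset.sum_sub_distrib, Finset.mul_sum]

theorem mutualInfo_reindex {κ : Type*} [Fintype κ] (e : κ ≃ ι)
    (E : ι → Matrix n n ℂ) : mutualInfo ρ₀ ρ₁ (E ∘ e) = mutualInfo ρ₀ ρ₁ E := by
  rw [mutualInfo_eq_sum, mutualInfo_eq_sum]
  ext t
  exact e.sum_comp fun b => outcomeInfo (prob ρ₀.op (E b)) (prob ρ₁.op (E b)) t

theorem mutualInfo_zero (E : ι → Matrix n n ℂ) : mutualInfo ρ₀ ρ₁ E 0 = 0 := by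
  rw [mutualInfo_eq_sum]
  exact Finset.sum_eq_zero fun b _ => outcomeInfo_zero _ _

theorem mutualInfo_one (E : ι → Matrix n n ℂ) : mutualInfo ρ₀ ρ₁ E 1 = 0 := by
  rw [mutualInfo_eq_sum]
  exact Finset.sum_eq_zero fun b _ => outcomeInfo_one _ _

theorem continuous_mutualInfo (E : ι → Matrix n n ℂ) : Continuous (mutualInfo ρ₀ ρ₁ E) := by
  rw [mutualInfo_eq_sum]
  refine continuous_finsetSum _ fun b _ => ?_
  exact continuous_outcomeInfo.comp
    (f := fun t : ℝ => (prob ρ₀.op (E b), prob ρ₁.op (E b), t)) (by fun_prop)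

variable [DecidableEq n] {E : ι → Matrix n n ℂ}

theorem contDiffAt_mutualInfo (hE : IsPOVM E) {t : ℝ} (ht : t ∈ Set.Ioo (0 : ℝ) 1) :
    ContDiffAt ℝ 2 (mutualInfo ρ₀ ρ₁ E) t := by
  rw [mutualInfo_eq_sum]
  refine ContDiffAt.sum fun b _ => contDiffAt_outcomeInfo ?_ ?_ ht
  · exact prob_nonneg ρ₀.posSemidef (hE.posSemidef b)
  · exact prob_nonneg ρ₁.posSemidef (hE.posSemidef b)

theorem hasDerivAt_mutualInfo (hE : IsPOVM E) {t : ℝ} (ht : t ∈ Set.Ioo (0 : ℝ) 1) :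
    HasDerivAt (mutualInfo ρ₀ ρ₁ E)
      (∑ b, outcomeInfoDeriv (prob ρ₀.op (E b)) (prob ρ₁.op (E b)) t) t := by
  rw [mutualInfo_eq_sum]
  exact HasDerivAt.fun_sum fun b _ => hasDerivAt_outcomeInfo
    (prob_nonneg ρ₀.posSemidef (hE.posSemidef b)) (prob_nonneg ρ₁.posSemidef (hE.posSemidef b)) ht

theorem hasDerivAt_sum_outcomeInfoDeriv (hE : IsPOVM E) {t : ℝ} (ht : t ∈ Set.Ioo (0 : ℝ) 1) :
    HasDerivAt (fun s => ∑ b, outcomeInfoDeriv (prob ρ₀.op (E b)) (prob ρ₁.op (E b)) s)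
      (-∑ b, prob (diff ρ₀ ρ₁) (E b) ^ 2 / prob (mean ρ₀ ρ₁ t) (E b)) t := by
  simp only [prob_diff, prob_mean, ← Finset.sum_neg_distrib]
  exact HasDerivAt.fun_sum fun b _ => hasDerivAt_outcomeInfoDeriv
    (prob_nonneg ρ₀.posSemidef (hE.posSemidef b)) (prob_nonneg ρ₁.posSemidef (hE.posSemidef b)) ht

theorem iteratedDeriv_two_mutualInfo (hE : IsPOVM E) {t : ℝ} (ht : t ∈ Set.Ioo (0 : ℝ) 1) :
    iteratedDeriv 2 (mutualInfo ρ₀ ρ₁ E) t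
      = -∑ b, prob (diff ρ₀ ρ₁) (E b) ^ 2 / prob (mean ρ₀ ρ₁ t) (E b) := by
  rw [iteratedDeriv_succ, iteratedDeriv_one]
  have h : deriv (mutualInfo ρ₀ ρ₁ E) =ᶠ[nhds t]
      fun s => ∑ b, outcomeInfoDeriv (prob ρ₀.op (E b)) (prob ρ₁.op (E b)) s := by
    filter_upwards [Ioo_mem_nhds ht.1 ht.2] with s hs
    exact (hasDerivAt_mutualInfo ρ₀ ρ₁ hE hs).deriv
  rw [h.deriv_eq]
  exact (hasDerivAt_sum_outcomeInfoDeriv ρ₀ ρ₁ hE ht).deriv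

/-- The traces of ρ𝓛Y and 𝓛ρY are complex conjugates, so each has half the real part of their sum.
-/
theorem re_trace_sylvester {t : ℝ} (ht : t ∈ Set.Ioo (0 : ℝ) 1) {Y : Matrix n n ℂ}
    (hY : Y.IsHermitian) :
    (mean ρ₀ ρ₁ t * loweredDiff ρ₀ ρ₁ t * Y).trace.re = (diff ρ₀ ρ₁ * Y).trace.re := by
  have h := congrArg (fun M => (M * Y).trace.re) (mean_mul_loweredDiff_add ρ₀ ρ₁ ht)
  have h2 : (loweredDiff ρ₀ ρ₁ t * mean ρ₀ ρ₁ t * Y).trace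
      = star (mean ρ₀ ρ₁ t * loweredDiff ρ₀ ρ₁ t * Y).trace := by
    rw [← Matrix.trace_conjTranspose, Matrix.conjTranspose_mul, Matrix.conjTranspose_mul, hY.eq,
      (loweredDiff_isHermitian ρ₀ ρ₁ t).eq, (mean_isHermitian ρ₀ ρ₁ t).eq, Matrix.trace_mul_comm]
  simp only [Matrix.add_mul, Matrix.trace_add, Matrix.smul_mul, Matrix.trace_smul, h2,
    Complex.add_re, Complex.star_def, Complex.conj_re, smul_eq_mul, Complex.mul_re,
    Complex.re_ofNat, Complex.im_ofNat, zero_mul, sub_zero] at h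
  linarith

/-- Cauchy–Schwarz for a single outcome of the measurement. -/
theorem prob_diff_sq_div_le {t : ℝ} (ht : t ∈ Set.Ioo (0 : ℝ) 1) {F : Matrix n n ℂ}
    (hF : F.PosSemidef) :
    prob (diff ρ₀ ρ₁) F ^ 2 / prob (mean ρ₀ ρ₁ t) F
      ≤ prob (loweredDiff ρ₀ ρ₁ t * mean ρ₀ ρ₁ t * loweredDiff ρ₀ ρ₁ t) F := by
  set L := loweredDiff ρ₀ ρ₁ t with hL
  set ρ := mean ρ₀ ρ₁ t with hρ
  have hLh : L.IsHermitian := loweredDiff_isHermitian ρ₀ ρ₁ t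
  have hρp : ρ.PosSemidef := mean_posSemidef ρ₀ ρ₁ (Set.Ioo_subset_Icc_self ht)
  have hd : (ρ * L * F).trace.re = prob (diff ρ₀ ρ₁) F :=
    re_trace_sylvester ρ₀ ρ₁ ht hF.isHermitian
  have hd' : (L * ρ * F).trace.re = prob (diff ρ₀ ρ₁) F := by
    rw [← hd, ← Complex.conj_re, ← Complex.star_def, ← Matrix.trace_conjTranspose,
      Matrix.conjTranspose_mul, Matrix.conjTranspose_mul, hF.isHermitian.eq, hLh.eq,
      hρp.isHermitian.eq, Matrix.trace_mul_comm]
  -- The quadratic is tr((1 - s𝓛)ρ(1 - s𝓛)F); the sign of its discriminant is the Cauchy–Schwarz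
  -- inequality.
  have hq : ∀ s : ℝ, 0 ≤ prob (L * ρ * L) F * (s * s) + -2 * prob (diff ρ₀ ρ₁) F * s
      + prob ρ F := by
    intro s
    have hpsd := hρp.mul_mul_conjTranspose_same (1 - (s : ℂ) • L)
    have h := prob_nonneg hpsd hF
    have hc : (1 - (s : ℂ) • L)ᴴ = 1 - (s : ℂ) • L := by
      rw [Matrix.conjTranspose_sub, Matrix.conjTranspose_smul, hLh.eq]
      simp
    have he : (1 - (s : ℂ) • L) * ρ * (1 - (s : ℂ) • L) * F
        = ρ * F - (s : ℂ) • (L * ρ * F) - (s : ℂ) • (ρ * L * F)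
          + (s : ℂ) • (s : ℂ) • (L * ρ * L * F) := by
      simp only [Matrix.sub_mul, Matrix.mul_sub, Matrix.one_mul, Matrix.mul_one, Matrix.smul_mul,
        Matrix.mul_smul, smul_sub]
      abel
    rw [hc, prob, he] at h
    simp only [Matrix.trace_add, Matrix.trace_sub, Matrix.trace_smul, smul_eq_mul, Complex.add_re,
      Complex.sub_re, Complex.re_ofReal_mul, hd, hd'] at h
    simp only [prob] at h ⊢
    linarith
  have hp := prob_nonneg hρp hF
  have hdis := discrim_le_zero hq
  rw [discrim] at hdis
  have hLL : 0 ≤ prob (L * ρ * L) F := by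
    have := hρp.mul_mul_conjTranspose_same L
    rw [hLh.eq] at this
    exact prob_nonneg this hF
  rcases hp.eq_or_lt with h0 | h0
  · rw [← h0, div_zero]
    exact hLL
  · rw [div_le_iff₀ h0]
    nlinarith

theorem re_trace_loweredDiff_sq {t : ℝ} (ht : t ∈ Set.Ioo (0 : ℝ) 1) :
    (loweredDiff ρ₀ ρ₁ t * mean ρ₀ ρ₁ t * loweredDiff ρ₀ ρ₁ t).trace.re
      = -curvature ρ₀ ρ₁ t := by
  rw [curvature, neg_neg, ← re_trace_sylvester ρ₀ ρ₁ ht (loweredDiff_isHermitian ρ₀ ρ₁ t),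
    Matrix.mul_assoc, Matrix.trace_mul_comm]

/-- Summing the bounds for single outcomes with ∑ E_b = 1 leaves tr(𝓛ρ𝓛) = tr(Δ𝓛). -/
theorem curvature_le_iteratedDeriv (hE : IsPOVM E) {t : ℝ} (ht : t ∈ Set.Ioo (0 : ℝ) 1) :
    curvature ρ₀ ρ₁ t ≤ -∑ b, prob (diff ρ₀ ρ₁) (E b) ^ 2 / prob (mean ρ₀ ρ₁ t) (E b) := by
  have h : ∑ b, prob (diff ρ₀ ρ₁) (E b) ^ 2 / prob (mean ρ₀ ρ₁ t) (E b)
      ≤ ∑ b, prob (loweredDiff ρ₀ ρ₁ t * mean ρ₀ ρ₁ t * loweredDiff ρ₀ ρ₁ t) (E b) :=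
    Finset.sum_le_sum fun b _ => prob_diff_sq_div_le ρ₀ ρ₁ ht (hE.posSemidef b)
  have h2 : ∑ b, prob (loweredDiff ρ₀ ρ₁ t * mean ρ₀ ρ₁ t * loweredDiff ρ₀ ρ₁ t) (E b)
      = -curvature ρ₀ ρ₁ t := by
    simp only [prob]
    rw [← Complex.re_sum, ← Matrix.trace_sum, ← Finset.mul_sum, hE.sum_eq_one, Matrix.mul_one,
      re_trace_loweredDiff_sq ρ₀ ρ₁ ht]
  linarith

end Measurement

theorem IsPOVM.reindex {n ι κ : Type*} [Fintype ι] [Fintype κ] [DecidableEq n]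
    {E : ι → Matrix n n ℂ}
    (hE : IsPOVM E) (e : κ ≃ ι) : IsPOVM (E ∘ e) where
  posSemidef b := hE.posSemidef (e b)
  sum_eq_one := (e.sum_comp E).trans hE.sum_eq_one

/-! ### Projective measurements; attainment of the minimum -/

section Basis

variable {n : Type*} [Fintype n]
  {v : OrthonormalBasis n ℂ (EuclideanSpace ℂ n)}

theorem mul_basisMeasurement {A : Matrix n n ℂ} {b : n} {μ : ℂ}
    (h : A *ᵥ (v b).ofLp = μ • (v b).ofLp) :
    A * basisMeasurement v b = μ • basisMeasurement v b := by
  rw [basisMeasurement, Matrix.mul_vecMulVec, h, Matrix.smul_vecMulVec]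

variable [DecidableEq n]

variable (v) in
theorem isPOVM_basisMeasurement : IsPOVM (basisMeasurement v) where
  posSemidef b := Matrix.posSemidef_vecMulVec_self_star _
  sum_eq_one := by
    have h := Matrix.mem_unitaryGroup_iff.1
      ((EuclideanSpace.basisFun n ℂ).toMatrix_orthonormalBasis_mem_unitary v)
    rw [← h]
    ext i j
    simp [Matrix.sum_apply, basisMeasurement, Matrix.vecMulVec_apply, Matrix.mul_apply,
      Module.Basis.toMatrix_apply]

variable (ρ₀ ρ₁ : DensityOperator n)

/-- For an eigenprojector with eigenvalue μ, tr(ΔE) = μ tr(ρE), so the quotient equals μ tr(ΔE), and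
these terms sum to tr(Δ𝓛). If tr(ρE) = 0, both sides vanish. -/
theorem sum_prob_sq_div_eigenbasis {t : ℝ} (ht : t ∈ Set.Ioo (0 : ℝ) 1)
    (hv : IsEigenbasis v (loweredDiff ρ₀ ρ₁ t)) :
    -∑ b, prob (diff ρ₀ ρ₁) (basisMeasurement v b) ^ 2
        / prob (mean ρ₀ ρ₁ t) (basisMeasurement v b) = curvature ρ₀ ρ₁ t := by
  choose μ hμ using hv
  have hP := isPOVM_basisMeasurement v
  have hd : ∀ b, prob (diff ρ₀ ρ₁) (basisMeasurement v b)
      = (μ b).re * prob (mean ρ₀ ρ₁ t) (basisMeasurement v b) := by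
    intro b
    have hEh := (hP.posSemidef b).isHermitian
    rw [prob, ← re_trace_sylvester ρ₀ ρ₁ ht hEh, Matrix.mul_assoc, mul_basisMeasurement (hμ b),
      Matrix.mul_smul, Matrix.trace_smul, smul_eq_mul, Complex.mul_re,
      trace_mul_im_eq_zero (mean_isHermitian ρ₀ ρ₁ t) hEh, mul_zero, sub_zero, prob]
  have hc : curvature ρ₀ ρ₁ t
      = -∑ b, (μ b).re * prob (diff ρ₀ ρ₁) (basisMeasurement v b) := by
    rw [curvature, ← Matrix.mul_one (diff ρ₀ ρ₁ * _), ← hP.sum_eq_one, Finset.mul_sum,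
      Matrix.trace_sum, Complex.re_sum]
    congr 1
    refine Finset.sum_congr rfl fun b _ => ?_
    rw [Matrix.mul_assoc, mul_basisMeasurement (hμ b), Matrix.mul_smul, Matrix.trace_smul,
      smul_eq_mul, Complex.mul_re,
      trace_mul_im_eq_zero (diff_isHermitian ρ₀ ρ₁) (hP.posSemidef b).isHermitian, mul_zero,
      sub_zero, prob]
  rw [hc]
  congr 1
  refine Finset.sum_congr rfl fun b _ => ?_
  rw [hd b]
  rcases eq_or_ne (prob (mean ρ₀ ρ₁ t) (basisMeasurement v b)) 0 with h0 | h0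
  · simp [h0]
  · field_simp

theorem iteratedDeriv_eigenbasis {t : ℝ} (ht : t ∈ Set.Ioo (0 : ℝ) 1)
    (hv : IsEigenbasis v (loweredDiff ρ₀ ρ₁ t)) :
    iteratedDeriv 2 (mutualInfo ρ₀ ρ₁ (basisMeasurement v)) t = curvature ρ₀ ρ₁ t := by
  rw [iteratedDeriv_two_mutualInfo ρ₀ ρ₁ (isPOVM_basisMeasurement v) ht,
    sum_prob_sq_div_eigenbasis ρ₀ ρ₁ ht hv]

theorem isLeast_curvature {t : ℝ} (ht : t ∈ Set.Ioo (0 : ℝ) 1) :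
    IsLeast (mutualInfoSecondDerivValues ρ₀ ρ₁ t) (curvature ρ₀ ρ₁ t) := by
  constructor
  · have hL := loweredDiff_isHermitian ρ₀ ρ₁ t
    refine ⟨Fintype.card n, basisMeasurement hL.eigenvectorBasis ∘ (Fintype.equivFin n).symm,
      (isPOVM_basisMeasurement _).reindex _, ?_⟩
    rw [mutualInfo_reindex]
    refine iteratedDeriv_eigenbasis ρ₀ ρ₁ ht fun b => ⟨hL.eigenvalues b, ?_⟩
    rw [hL.mulVec_eigenvectorBasis b]
    rfl
  · rintro x ⟨N, E, hE, rfl⟩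
    rw [iteratedDeriv_two_mutualInfo ρ₀ ρ₁ hE ht]
    exact curvature_le_iteratedDeriv ρ₀ ρ₁ hE ht

end Basis

/-! ### Concave comparison and integrating a singular second derivative -/

section RealAnalysis

open Set MeasureTheory

theorem concaveOn_of_hasDerivAt2_nonpos {f f' f'' : ℝ → ℝ} {a b : ℝ}
    (hf : ContinuousOn f (Icc a b)) (hf' : ∀ t ∈ Ioo a b, HasDerivAt f (f' t) t)
    (hf'' : ∀ t ∈ Ioo a b, HasDerivAt f' (f'' t) t) (h : ∀ t ∈ Ioo a b, f'' t ≤ 0) :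
    ConcaveOn ℝ (Icc a b) f := by
  refine concaveOn_of_hasDerivWithinAt2_nonpos (f' := f') (f'' := f'') (convex_Icc a b) hf ?_ ?_ ?_
  all_goals
    rw [interior_Icc]
    intro t ht
  · exact (hf' t ht).hasDerivWithinAt
  · exact (hf'' t ht).hasDerivWithinAt
  · exact h t ht

theorem nonneg_of_concaveOn_Icc {f : ℝ → ℝ} {a b : ℝ} (hf : ConcaveOn ℝ (Icc a b) f)
    (ha : 0 ≤ f a) (hb : 0 ≤ f b) {t : ℝ} (ht : t ∈ Icc a b) : 0 ≤ f t := by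
  have hab := ht.1.trans ht.2
  exact (le_min ha hb).trans
    (hf.min_le_of_mem_Icc (left_mem_Icc.2 hab) (right_mem_Icc.2 hab) ht)

/-- The logarithmic function g has derivative -K/(t(1-t)). Since A decreases, A - g increases and
both vanish at 1/2, A lies between 0 and g. -/
theorem abs_le_log_of_hasDerivAt {A c : ℝ → ℝ} {K : ℝ} (hA : ∀ t ∈ Ioo (0 : ℝ) 1,
    HasDerivAt A (c t) t) (hA0 : A (1 / 2) = 0) (h0 : ∀ t ∈ Ioo (0 : ℝ) 1, c t ≤ 0)
    (hK : ∀ t ∈ Ioo (0 : ℝ) 1, -(K / (t * (1 - t))) ≤ c t) {t : ℝ} (ht : t ∈ Ioo (0 : ℝ) 1) :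
    |A t| ≤ |K * (Real.log (1 - t) - Real.log t)| := by
  have hhalf : (1 / 2 : ℝ) ∈ Ioo (0 : ℝ) 1 := by norm_num
  set g : ℝ → ℝ := fun t => K * (Real.log (1 - t) - Real.log t) with hg
  have hg' : ∀ t ∈ Ioo (0 : ℝ) 1, HasDerivAt g (-(K / (t * (1 - t)))) t := by
    intro t ht
    have h1 : (1 - t) ≠ 0 := by linarith [ht.2]
    have h2 : t ≠ 0 := ht.1.ne'
    have h := ((((hasDerivAt_id t).const_sub 1).log h1).sub
      (Real.hasDerivAt_log h2)).const_mul K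
    refine h.congr_deriv ?_
    simp only [id]
    field_simp
    ring
  have hg0 : g (1 / 2) = 0 := by norm_num [hg]
  have hanti : AntitoneOn A (Ioo 0 1) := by
    refine antitoneOn_of_hasDerivWithinAt_nonpos (f' := c) (convex_Ioo 0 1)
      (fun t ht => (hA t ht).continuousAt.continuousWithinAt) ?_ ?_
    · rw [interior_Ioo]
      exact fun t ht => (hA t ht).hasDerivWithinAt
    · rw [interior_Ioo]
      exact h0
  have hmono : MonotoneOn (fun t => A t - g t) (Ioo 0 1) := by
    refine monotoneOn_of_hasDerivWithinAt_nonneg (f' := fun t => c t - -(K / (t * (1 - t))))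
      (convex_Ioo 0 1)
      (fun t ht => ((hA t ht).sub (hg' t ht)).continuousAt.continuousWithinAt) ?_ ?_
    · rw [interior_Ioo]
      exact fun t ht => ((hA t ht).sub (hg' t ht)).hasDerivWithinAt
    · rw [interior_Ioo]
      exact fun t ht => sub_nonneg.2 (hK t ht)
  change |A t| ≤ |g t|
  rcases le_total t (1 / 2) with h | h
  · have h1 := hanti ht hhalf h
    have h2 := hmono ht hhalf h
    simp only [hA0, hg0] at h1 h2
    rw [abs_of_nonneg h1, abs_of_nonneg (by linarith)]
    linarith
  · have h1 := hanti hhalf ht h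
    have h2 := hmono hhalf ht h
    simp only [hA0, hg0] at h1 h2
    rw [abs_of_nonpos h1, abs_of_nonpos (by linarith)]
    linarith

theorem hasDerivAt_integral_of_continuousOn_Ioo {c : ℝ → ℝ} {x t : ℝ}
    (hc : ContinuousOn c (Ioo 0 1)) (hx : IntervalIntegrable c volume x t)
    (ht : t ∈ Ioo (0 : ℝ) 1) : HasDerivAt (fun u => ∫ s in x..u, c s) (c t) t :=
  intervalIntegral.integral_hasDerivAt_right hx
    (hc.stronglyMeasurableAtFilter isOpen_Ioo t ht) (hc.continuousAt (isOpen_Ioo.mem_nhds ht))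

/-- A nonpositive continuous function on `(0,1)` that is `O(1/(t(1-t)))` at the end points is the
second derivative of a continuous function on `[0,1]` that vanishes at the end points. -/
theorem exists_second_primitive {c : ℝ → ℝ} {K : ℝ} (hc : ContinuousOn c (Ioo 0 1))
    (h0 : ∀ t ∈ Ioo (0 : ℝ) 1, c t ≤ 0)
    (hK : ∀ t ∈ Ioo (0 : ℝ) 1, -(K / (t * (1 - t))) ≤ c t) :
    ∃ L A : ℝ → ℝ, ContinuousOn L (Icc 0 1) ∧ L 0 = 0 ∧ L 1 = 0 ∧
      (∀ t ∈ Ioo (0 : ℝ) 1, HasDerivAt L (A t) t) ∧ ∀ t ∈ Ioo (0 : ℝ) 1, HasDerivAt A (c t) t := by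
  have hhalf : (1 / 2 : ℝ) ∈ Ioo (0 : ℝ) 1 := by norm_num
  set A : ℝ → ℝ := fun t => ∫ s in (1 / 2 : ℝ)..t, c s with hAdef
  have hA : ∀ t ∈ Ioo (0 : ℝ) 1, HasDerivAt A (c t) t := by
    intro t ht
    refine hasDerivAt_integral_of_continuousOn_Ioo hc ?_ ht
    exact (hc.mono (OrdConnected.uIcc_subset ordConnected_Ioo hhalf ht)).intervalIntegrable
  have hA0 : A (1 / 2) = 0 := by simp [hAdef]
  have hAc : ContinuousOn A (Ioo 0 1) := fun t ht => (hA t ht).continuousAt.continuousWithinAt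
  -- The logarithmic majorant is integrable up to both end points, hence so is A.
  have hlog : IntervalIntegrable (fun t : ℝ => K * (Real.log (1 - t) - Real.log t)) volume 0 1 := by
    have h1 : IntervalIntegrable Real.log volume 0 1 := intervalIntegral.intervalIntegrable_log'
    have h2 : IntervalIntegrable (fun t : ℝ => Real.log (1 - t)) volume 0 1 := by
      simpa using (h1.comp_sub_left 1).symm
    exact (h2.sub h1).const_mul K
  have hAi : IntervalIntegrable A volume 0 1 := by
    have hset : (volume : Measure ℝ).restrict (uIoc 0 1) = volume.restrict (Ioo 0 1) := by
      rw [uIoc_of_le zero_le_one]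
      exact Measure.restrict_congr_set Ioo_ae_eq_Ioc.symm
    refine hlog.mono_fun ?_ ?_
    · rw [hset]
      exact hAc.aestronglyMeasurable measurableSet_Ioo
    · rw [hset]
      filter_upwards [ae_restrict_mem measurableSet_Ioo] with t ht
      exact abs_le_log_of_hasDerivAt hA hA0 h0 hK ht
  set F : ℝ → ℝ := fun t => ∫ s in (0 : ℝ)..t, A s with hF
  have hFc : ContinuousOn F (Icc 0 1) := by
    have h := intervalIntegral.continuousOn_primitive_interval' hAi left_mem_uIcc
    rwa [uIcc_of_le zero_le_one] at h
  -- Subtracting a linear function corrects the value at 1 and leaves the second derivative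
  -- unchanged.
  refine ⟨fun t => F t - t * F 1, fun t => A t - 1 * F 1, by fun_prop, by simp [hF], by simp, ?_, ?_⟩
  · intro t ht
    refine HasDerivAt.sub ?_ ((hasDerivAt_id t).mul_const (F 1))
    refine hasDerivAt_integral_of_continuousOn_Ioo hAc (hAi.mono_set ?_) ht
    rw [uIcc_of_le ht.1.le, uIcc_of_le zero_le_one]
    exact Icc_subset_Icc_right ht.2.le
  · exact fun t ht => (hA t ht).sub_const _

end RealAnalysis

/-! ### Existence and uniqueness of L, and the bound on the mutual information -/

section CurvatureBound

variable {n : Type*} [Fintype n] [DecidableEq n] (ρ₀ ρ₁ : DensityOperator n)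

theorem prob_mean_loweredDiff_mul_self {t : ℝ} (ht : t ∈ Set.Ioo (0 : ℝ) 1) :
    prob (mean ρ₀ ρ₁ t) (loweredDiff ρ₀ ρ₁ t * loweredDiff ρ₀ ρ₁ t) = -curvature ρ₀ ρ₁ t := by
  rw [← re_trace_loweredDiff_sq ρ₀ ρ₁ ht, prob, Matrix.trace_mul_comm (_ * mean ρ₀ ρ₁ t),
    Matrix.trace_mul_comm (mean ρ₀ ρ₁ t), Matrix.mul_assoc]

/-- `-tr(Δ 𝓛_ρ(Δ))` is an infimum of affine functions of `t`. -/
theorem curvature_le_of_isHermitian {t : ℝ} (ht : t ∈ Set.Ioo (0 : ℝ) 1) {Y : Matrix n n ℂ}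
    (hY : Y.IsHermitian) :
    curvature ρ₀ ρ₁ t ≤ prob (mean ρ₀ ρ₁ t) (Y * Y) - 2 * (diff ρ₀ ρ₁ * Y).trace.re := by
  set L := loweredDiff ρ₀ ρ₁ t with hL
  have hLh : L.IsHermitian := loweredDiff_isHermitian ρ₀ ρ₁ t
  -- Completing the square: the deficit in the claimed inequality is tr(ρ(Y - 𝓛)²).
  have hpos : 0 ≤ prob (mean ρ₀ ρ₁ t) ((Y - L)ᴴ * (Y - L)) :=
    prob_nonneg (mean_posSemidef ρ₀ ρ₁ (Set.Ioo_subset_Icc_self ht))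
      (Matrix.posSemidef_conjTranspose_mul_self _)
  have hd : (mean ρ₀ ρ₁ t * L * Y).trace.re = (diff ρ₀ ρ₁ * Y).trace.re :=
    re_trace_sylvester ρ₀ ρ₁ ht hY
  have hd' : (mean ρ₀ ρ₁ t * (Y * L)).trace.re = (diff ρ₀ ρ₁ * Y).trace.re := by
    rw [← hd, ← Complex.conj_re, ← Complex.star_def, ← Matrix.trace_conjTranspose,
      Matrix.conjTranspose_mul, Matrix.conjTranspose_mul, hY.eq, hLh.eq,
      (mean_isHermitian ρ₀ ρ₁ t).eq, Matrix.trace_mul_comm, Matrix.mul_assoc]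
  have hc : (mean ρ₀ ρ₁ t * (L * L)).trace.re = -curvature ρ₀ ρ₁ t :=
    prob_mean_loweredDiff_mul_self ρ₀ ρ₁ ht
  have he : mean ρ₀ ρ₁ t * ((Y - L) * (Y - L)) = mean ρ₀ ρ₁ t * (Y * Y)
      - mean ρ₀ ρ₁ t * (Y * L) - mean ρ₀ ρ₁ t * L * Y + mean ρ₀ ρ₁ t * (L * L) := by
    noncomm_ring
  rw [(hY.sub hLh).eq, prob, he] at hpos
  simp only [Matrix.trace_add, Matrix.trace_sub, Complex.add_re, Complex.sub_re, hd, hd', hc]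
    at hpos
  rw [prob]
  linarith

theorem curvature_eq_of_loweredDiff {t : ℝ} (ht : t ∈ Set.Ioo (0 : ℝ) 1) :
    curvature ρ₀ ρ₁ t = prob (mean ρ₀ ρ₁ t) (loweredDiff ρ₀ ρ₁ t * loweredDiff ρ₀ ρ₁ t)
      - 2 * (diff ρ₀ ρ₁ * loweredDiff ρ₀ ρ₁ t).trace.re := by
  rw [prob_mean_loweredDiff_mul_self ρ₀ ρ₁ ht, curvature]
  ring

/-- The infimum of affine functions is attained at Y = 𝓛. Concavity gives continuity without any
continuity of eigenvectors in t. -/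
theorem concaveOn_curvature : ConcaveOn ℝ (Set.Ioo 0 1) (curvature ρ₀ ρ₁) := by
  refine ⟨convex_Ioo 0 1, fun x hx y hy a b ha hb hab => ?_⟩
  have hz := (convex_Ioo (0 : ℝ) 1) hx hy ha hb hab
  simp only [smul_eq_mul] at hz ⊢
  -- The optimal Y at the intermediate point serves as a trial operator at both x and y.
  have hY := loweredDiff_isHermitian ρ₀ ρ₁ (a * x + b * y)
  have h1 := curvature_le_of_isHermitian ρ₀ ρ₁ hx hY
  have h2 := curvature_le_of_isHermitian ρ₀ ρ₁ hy hY
  rw [curvature_eq_of_loweredDiff ρ₀ ρ₁ hz]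
  rw [prob_mean] at h1 h2 ⊢
  have hb' : b = 1 - a := by linarith
  subst hb'
  nlinarith [mul_le_mul_of_nonneg_left h1 ha, mul_le_mul_of_nonneg_left h2 hb]

theorem continuousOn_curvature : ContinuousOn (curvature ρ₀ ρ₁) (Set.Ioo 0 1) :=
  (concaveOn_curvature ρ₀ ρ₁).continuousOn isOpen_Ioo

theorem exists_isCurvatureBound : ∃ L, IsCurvatureBound ρ₀ ρ₁ L := by
  obtain ⟨L, A, hLc, hL0, hL1, hL, hA⟩ := exists_second_primitive
    (continuousOn_curvature ρ₀ ρ₁)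
    (fun t ht => curvature_nonpos ρ₀ ρ₁ (Set.Ioo_subset_Icc_self ht))
    (fun t ht => neg_le_curvature ρ₀ ρ₁ ht)
  refine ⟨L, hLc, hL0, hL1, fun t ht => (hL t ht).differentiableAt, fun t ht => ?_⟩
  refine (hA t ht).congr_of_eventuallyEq ?_
  filter_upwards [Ioo_mem_nhds ht.1 ht.2] with s hs
  exact (hL s hs).deriv

variable {ρ₀ ρ₁} {L : ℝ → ℝ}

theorem IsCurvatureBound.le_of_le {L' : ℝ → ℝ} (hL : IsCurvatureBound ρ₀ ρ₁ L)
    (hL' : IsCurvatureBound ρ₀ ρ₁ L') {t : ℝ} (ht : t ∈ Set.Icc (0 : ℝ) 1) : L' t ≤ L t := by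
  rw [← sub_nonneg]
  refine nonneg_of_concaveOn_Icc (f := fun t => L t - L' t) (concaveOn_of_hasDerivAt2_nonpos
    (f' := fun t => deriv L t - deriv L' t)
    (f'' := fun t => curvature ρ₀ ρ₁ t - curvature ρ₀ ρ₁ t) (hL.continuousOn.sub hL'.continuousOn)
    (fun t ht => ?_) (fun t ht => ?_) (fun t _ => (sub_self _).le)) ?_ ?_ ht
  · exact (hL.differentiableAt t ht).hasDerivAt.sub (hL'.differentiableAt t ht).hasDerivAt
  · exact (hL.hasDerivAt_deriv t ht).sub (hL'.hasDerivAt_deriv t ht)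
  · simp [hL.zero, hL'.zero]
  · simp [hL.one, hL'.one]

/-- The difference L - J_E is concave, because its second derivative is nonpositive, and it vanishes
at both ends. -/
theorem IsCurvatureBound.mutualInfo_le {ι : Type*} [Fintype ι] {E : ι → Matrix n n ℂ}
    (hL : IsCurvatureBound ρ₀ ρ₁ L) (hE : IsPOVM E) {t : ℝ} (ht : t ∈ Set.Icc (0 : ℝ) 1) :
    mutualInfo ρ₀ ρ₁ E t ≤ L t := by
  rw [← sub_nonneg]
  refine nonneg_of_concaveOn_Icc (f := fun t => L t - mutualInfo ρ₀ ρ₁ E t)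
    (concaveOn_of_hasDerivAt2_nonpos
    (hL.continuousOn.sub (continuous_mutualInfo ρ₀ ρ₁ E).continuousOn)
    (fun t ht => (hL.differentiableAt t ht).hasDerivAt.sub (hasDerivAt_mutualInfo ρ₀ ρ₁ hE ht))
    (fun t ht => (hL.hasDerivAt_deriv t ht).sub (hasDerivAt_sum_outcomeInfoDeriv ρ₀ ρ₁ hE ht))
    (fun t ht => sub_nonpos.2 (curvature_le_iteratedDeriv ρ₀ ρ₁ hE ht))) ?_ ?_ ht
  · simp [hL.zero, mutualInfo_zero]
  · simp [hL.one, mutualInfo_one]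

end CurvatureBound

/-! ### Compactness of convex hulls in finite dimension -/

section ConvexHull

open Set Module

/-- The convex hull of a compact set in a finite-dimensional space is compact. -/
theorem isCompact_convexHull {V : Type*} [AddCommGroup V] [Module ℝ V] [TopologicalSpace V]
    [ContinuousAdd V] [ContinuousSMul ℝ V] [FiniteDimensional ℝ V] {s : Set V}
    (hs : IsCompact s) : IsCompact (convexHull ℝ s) := by
  -- By Carathéodory, dim V + 1 points suffice, so the hull is a continuous image of a simplex times
  -- a power of s.
  set m := finrank ℝ V + 1 with hm
  have hK : IsCompact (stdSimplex ℝ (Fin m) ×ˢ Set.pi univ fun _ : Fin m => s) :=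
    (isCompact_stdSimplex ℝ (Fin m)).prod (isCompact_univ_pi fun _ => hs)
  have hcont : Continuous fun p : (Fin m → ℝ) × (Fin m → V) => ∑ i, p.1 i • p.2 i := by
    fun_prop
  suffices convexHull ℝ s = (fun p : (Fin m → ℝ) × (Fin m → V) => ∑ i, p.1 i • p.2 i) ''
      (stdSimplex ℝ (Fin m) ×ˢ Set.pi univ fun _ : Fin m => s) by
    rw [this]
    exact hK.image hcont
  apply Subset.antisymm
  · intro x hx
    obtain ⟨ι, _, z, w, hz, hind, hw, hw1, rfl⟩ := eq_pos_convex_span_of_mem_convexHull hx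
    have hcard : Fintype.card ι ≤ Fintype.card (Fin m) := by
      rw [Fintype.card_fin]
      exact hind.card_le_finrank_succ.trans
        (Nat.add_le_add_right (Submodule.finrank_le _) 1)
    obtain ⟨e⟩ := Function.Embedding.nonempty_of_card_le hcard
    obtain ⟨i₀⟩ : Nonempty ι := by
      by_contra h
      rw [not_nonempty_iff] at h
      simp at hw1
    -- Surplus indices receive weight 0 and an arbitrary point of s.
    refine ⟨(Function.extend e w 0, Function.extend e z fun _ => z i₀), ⟨⟨fun j => ?_, ?_⟩,
      fun j _ => ?_⟩, ?_⟩
    · by_cases hj : ∃ i, e i = j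
      · obtain ⟨i, rfl⟩ := hj
        simpa [e.injective.extend_apply] using (hw i).le
      · simp [Function.extend_apply' _ _ _ hj]
    · rw [← hw1]
      refine (Fintype.sum_of_injective e e.injective _ _ (fun j hj => ?_) fun i => ?_).symm
      · exact Function.extend_apply' _ _ _ hj
      · exact (e.injective.extend_apply _ _ _).symm
    · by_cases hj : ∃ i, e i = j
      · obtain ⟨i, rfl⟩ := hj
        simpa [e.injective.extend_apply] using hz (mem_range_self i)
      · simpa [Function.extend_apply' _ _ _ hj] using hz (mem_range_self i₀)
    · refine (Fintype.sum_of_injective e e.injective _ _ (fun j hj => ?_) fun i => ?_).symm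
      · simp [Function.extend_apply' _ _ _ hj]
      · simp [e.injective.extend_apply]
  · rintro _ ⟨⟨w, z⟩, ⟨⟨hw, hw1⟩, hz⟩, rfl⟩
    exact (convex_convexHull ℝ s).sum_mem (fun i _ => hw i) hw1
      fun i _ => subset_convexHull ℝ s (hz i (mem_univ i))

end ConvexHull

/-! ### Existence of an optimal measurement -/

section Accessible

variable {n : Type*} [Fintype n]

variable (n) in
theorem isCompact_density :
    IsCompact {E : Matrix n n ℂ | E.PosSemidef ∧ E.trace = 1} := by
  have hK : IsCompact (Set.pi Set.univ fun _ : n => Set.pi Set.univ fun _ : n =>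
      Metric.closedBall (0 : ℂ) 1) :=
    isCompact_univ_pi fun _ => isCompact_univ_pi fun _ => isCompact_closedBall 0 1
  refine IsCompact.of_isClosed_subset (X := Matrix n n ℂ) hK ?_ ?_
  · simp only [Matrix.posSemidef_iff_dotProduct_mulVec, Set.ofPred_and, Set.ofPred_forall]
    refine IsClosed.inter (IsClosed.inter ?_ (isClosed_iInter fun x => ?_)) ?_
    · exact isClosed_eq (by fun_prop) continuous_id
    · refine isClosed_le continuous_const ?_
      simp only [dotProduct, Matrix.mulVec]
      fun_prop
    · exact isClosed_eq (by fun_prop) continuous_const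
  · rintro E ⟨hE, h1⟩ a - b -
    rw [mem_closedBall_zero_iff, ← sq_le_one_iff₀ (norm_nonneg _)]
    exact (norm_sq_le_of_posSemidef hE a b).trans
      (mul_le_one₀ (diag_re_le_one hE h1 a) (diag_re_nonneg hE b) (diag_re_le_one hE h1 b))

theorem prob_smul (ρ E : Matrix n n ℂ) (c : ℝ) : prob ρ ((c : ℂ) • E) = c * prob ρ E := by
  rw [prob, Matrix.mul_smul, Matrix.trace_smul, smul_eq_mul, Complex.re_ofReal_mul, prob]

variable (ρ₀ ρ₁ : DensityOperator n)

/-- The contribution of an outcome with operator `E` to the mutual information. -/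
noncomputable def opInfo (t : ℝ) (E : Matrix n n ℂ) : ℝ :=
  outcomeInfo (prob ρ₀.op E) (prob ρ₁.op E) t

theorem continuous_opInfo (t : ℝ) : Continuous (opInfo ρ₀ ρ₁ t) := by
  have h : ∀ ρ : Matrix n n ℂ, Continuous (prob ρ) := by
    intro ρ
    unfold prob
    fun_prop
  exact continuous_outcomeInfo.comp
    (f := fun E => (prob ρ₀.op E, prob ρ₁.op E, t)) (by fun_prop)

theorem opInfo_smul (t c : ℝ) (E : Matrix n n ℂ) :
    opInfo ρ₀ ρ₁ t ((c : ℂ) • E) = c * opInfo ρ₀ ρ₁ t E := by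
  rw [opInfo, prob_smul, prob_smul, outcomeInfo_mul, opInfo]

theorem mutualInfo_eq_sum_opInfo {ι : Type*} [Fintype ι] (E : ι → Matrix n n ℂ) (t : ℝ) :
    mutualInfo ρ₀ ρ₁ E t = ∑ b, opInfo ρ₀ ρ₁ t (E b) := by
  rw [mutualInfo_eq_sum]
  rfl

theorem nonempty_index (ρ : DensityOperator n) : Nonempty n := by
  by_contra h
  rw [not_nonempty_iff] at h
  have := ρ.trace_eq_one
  simp [Matrix.trace] at this

variable [DecidableEq n]

theorem mutualInfo_mem_values {ι : Type*} [Fintype ι] {E : ι → Matrix n n ℂ} (hE : IsPOVM E)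
    (t : ℝ) : mutualInfo ρ₀ ρ₁ E t ∈ mutualInfoValues ρ₀ ρ₁ t :=
  ⟨Fintype.card ι, E ∘ (Fintype.equivFin ι).symm, hE.reindex _, by rw [mutualInfo_reindex]⟩

/-- A POVM is a convex combination of trace-one effects with weights tr(E_b)/D and barycentre 1/D.
By homogeneity its information is D times the same combination of their `opInfo`. The values thus
come from a slice of the convex hull of a graph over a compact set, with no prior bound on the
number of outcomes. -/
theorem mutualInfoValues_eq_image (t : ℝ) :
    mutualInfoValues ρ₀ ρ₁ t = (fun p : Matrix n n ℂ × ℝ => (Fintype.card n : ℝ) * p.2) ''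
      (convexHull ℝ ((fun E => (E, opInfo ρ₀ ρ₁ t E)) ''
          {E : Matrix n n ℂ | E.PosSemidef ∧ E.trace = 1}) ∩
        {p | ((Fintype.card n : ℝ) : ℂ) • p.1 = 1}) := by
  have := nonempty_index ρ₀
  set D : ℝ := (Fintype.card n : ℝ) with hD
  have hD0 : 0 < D := by rw [hD]; exact_mod_cast Fintype.card_pos
  apply Set.Subset.antisymm
  · rintro x ⟨N, E, hE, rfl⟩
    have htr : ∀ b, (E b).trace = ((E b).trace.re : ℂ) := by
      intro b
      have h := (Complex.le_def.1 (hE.posSemidef b).trace_nonneg).2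
      exact Complex.ext (by simp) (by simpa using h.symm)
    have htr0 : ∀ b, 0 ≤ (E b).trace.re := fun b =>
      (Complex.le_def.1 (hE.posSemidef b).trace_nonneg).1
    let z : Fin N → Matrix n n ℂ := fun b =>
      if (E b).trace.re = 0 then ρ₀.op else (((E b).trace.re⁻¹ : ℝ) : ℂ) • E b
    have hz : ∀ b, (z b).PosSemidef ∧ (z b).trace = 1 := by
      intro b
      by_cases h : (E b).trace.re = 0
      · simp only [z, if_pos h]
        exact ⟨ρ₀.posSemidef, ρ₀.trace_eq_one⟩
      · simp only [z, if_neg h]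
        refine ⟨(hE.posSemidef b).smul (Complex.zero_le_real.2 (inv_nonneg.2 (htr0 b))), ?_⟩
        rw [Matrix.trace_smul, htr b, smul_eq_mul, Complex.ofReal_re, ← Complex.ofReal_mul,
          inv_mul_cancel₀ h, Complex.ofReal_one]
    have hEz : ∀ b, E b = ((E b).trace.re : ℂ) • z b := by
      intro b
      by_cases h : (E b).trace.re = 0
      · rw [h, Complex.ofReal_zero, zero_smul]
        refine (hE.posSemidef b).trace_eq_zero_iff.1 ?_
        rw [htr b, h, Complex.ofReal_zero]
      · simp only [z, if_neg h]
        rw [smul_smul, ← Complex.ofReal_mul, mul_inv_cancel₀ h, Complex.ofReal_one, one_smul]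
    have hw1 : ∑ b, (E b).trace.re / D = 1 := by
      rw [← Finset.sum_div, ← Complex.re_sum, ← Matrix.trace_sum, hE.sum_eq_one, Matrix.trace_one,
        Complex.natCast_re, ← hD, div_self hD0.ne']
    refine ⟨∑ b, ((E b).trace.re / D) • (z b, opInfo ρ₀ ρ₁ t (z b)), ⟨?_, ?_⟩, ?_⟩
    · exact (convex_convexHull ℝ _).sum_mem (fun b _ => div_nonneg (htr0 b) hD0.le) hw1
        fun b _ => subset_convexHull ℝ _ ⟨z b, hz b, rfl⟩
    · rw [Set.mem_ofPred_eq, Prod.fst_sum, Finset.smul_sum, ← hE.sum_eq_one]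
      refine Finset.sum_congr rfl fun b _ => ?_
      conv_rhs => rw [hEz b]
      rw [Prod.smul_fst, ← Complex.coe_smul, smul_smul, ← Complex.ofReal_mul,
        mul_div_cancel₀ _ hD0.ne']
    · simp only [Prod.snd_sum, Finset.mul_sum]
      rw [mutualInfo_eq_sum_opInfo]
      refine Finset.sum_congr rfl fun b _ => ?_
      conv_rhs => rw [hEz b]
      rw [opInfo_smul, Prod.smul_snd, smul_eq_mul, ← mul_assoc, mul_div_cancel₀ _ hD0.ne']
  · rintro _ ⟨p, ⟨hp, hp1⟩, rfl⟩
    obtain ⟨ι, _, w, y, hw, hw1, hy, rfl⟩ := mem_convexHull_iff_exists_fintype.1 hp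
    choose z hz hzy using hy
    have hsum : ∑ i, (((D * w i : ℝ) : ℂ) • z i) = 1 := by
      rw [← hp1, Prod.fst_sum, Finset.smul_sum]
      refine Finset.sum_congr rfl fun i _ => ?_
      rw [← hzy i, Prod.smul_fst, ← Complex.coe_smul, smul_smul, ← Complex.ofReal_mul]
    have hE : IsPOVM fun i => ((D * w i : ℝ) : ℂ) • z i :=
      ⟨fun i => (hz i).1.smul (Complex.zero_le_real.2 (mul_nonneg hD0.le (hw i))), hsum⟩
    convert mutualInfo_mem_values ρ₀ ρ₁ hE t using 1
    simp only [mutualInfo_eq_sum_opInfo, Prod.snd_sum, Finset.mul_sum, opInfo_smul]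
    refine Finset.sum_congr rfl fun i _ => ?_
    rw [← hzy i, Prod.smul_snd, smul_eq_mul, mul_assoc]

theorem isGreatest_accessibleInfo (t : ℝ) :
    IsGreatest (mutualInfoValues ρ₀ ρ₁ t) (accessibleInfo ρ₀ ρ₁ t) := by
  have hc : IsCompact (mutualInfoValues ρ₀ ρ₁ t) := by
    rw [mutualInfoValues_eq_image]
    refine IsCompact.image ?_ (by fun_prop)
    refine (isCompact_convexHull ((isCompact_density n).image ?_)).inter_right ?_
    · exact continuous_id.prodMk (continuous_opInfo ρ₀ ρ₁ t)
    · exact isClosed_eq (by fun_prop) continuous_const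
  have hne : (mutualInfoValues ρ₀ ρ₁ t).Nonempty :=
    ⟨_, mutualInfo_mem_values ρ₀ ρ₁ (isPOVM_basisMeasurement (EuclideanSpace.basisFun n ℂ)) t⟩
  obtain ⟨x, hx⟩ := hc.exists_isGreatest hne
  rw [accessibleInfo, hx.csSup_eq]
  exact hx

end Accessible

/-! ### Scalar inequalities for the expansion of -x ln x in powers of 1 - x -/

section Scalar

open Finset

/-- The complete homogeneous polynomial of degree `k` in two variables. -/
noncomputable def completeHom (k : ℕ) (x y : ℝ) : ℝ := ∑ i ∈ range (k + 1), x ^ i * y ^ (k - i)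

theorem completeHom_succ_left (k : ℕ) (x y : ℝ) :
    completeHom (k + 1) x y = y * completeHom k x y + x ^ (k + 1) := by
  rw [completeHom, sum_range_succ, completeHom, mul_sum, Nat.sub_self, pow_zero, mul_one]
  congr 1
  refine sum_congr rfl fun i hi => ?_
  rw [Nat.succ_sub (Nat.lt_succ_iff.1 (mem_range.1 hi)), pow_succ]
  ring

theorem completeHom_comm (k : ℕ) (x y : ℝ) : completeHom k x y = completeHom k y x := by
  rw [completeHom, ← sum_range_reflect, completeHom]
  refine sum_congr rfl fun i hi => ?_
  have := mem_range.1 hi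
  rw [show k + 1 - 1 - i = k - i by omega, show k - (k - i) = i by omega, mul_comm]

theorem completeHom_nonneg (k : ℕ) {x y : ℝ} (hx : 0 ≤ x) (hy : 0 ≤ y) :
    0 ≤ completeHom k x y :=
  sum_nonneg fun _ _ => by positivity

theorem pow_sub_mul_pow_sub_nonneg {x y : ℝ} (hx : 0 ≤ x) (hy : 0 ≤ y) (i j : ℕ) :
    0 ≤ (x ^ i - y ^ i) * (x ^ j - y ^ j) := by
  rcases le_total x y with h | h
  · exact mul_nonneg_of_nonpos_of_nonpos (sub_nonpos.2 (pow_le_pow_left₀ hx h i))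
      (sub_nonpos.2 (pow_le_pow_left₀ hx h j))
  · exact mul_nonneg (sub_nonneg.2 (pow_le_pow_left₀ hy h i))
      (sub_nonneg.2 (pow_le_pow_left₀ hy h j))

/-- The rearrangement inequality: x^i and x^j are ordered alike in x, so each symmetrised monomial
is at most x^(k+1) + y^(k+1). -/
theorem add_mul_completeHom_le (k : ℕ) {x y : ℝ} (hx : 0 ≤ x) (hy : 0 ≤ y) :
    (x + y) * completeHom k x y ≤ (k + 1) * (x ^ (k + 1) + y ^ (k + 1)) := by
  have h : (x + y) * completeHom k x y
      = ∑ i ∈ range (k + 1), (x ^ (i + 1) * y ^ (k - i) + y ^ (i + 1) * x ^ (k - i)) := by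
    rw [add_mul, sum_add_distrib, completeHom, mul_sum]
    rw [← completeHom, completeHom_comm, completeHom, mul_sum]
    congr 1 <;>
    · refine sum_congr rfl fun i _ => ?_
      rw [pow_succ]
      ring
  have h2 : (k + 1) * (x ^ (k + 1) + y ^ (k + 1))
      = ∑ _i ∈ range (k + 1), (x ^ (k + 1) + y ^ (k + 1)) := by
    rw [sum_const, card_range, nsmul_eq_mul]
    push_cast
    rfl
  rw [h, h2]
  refine sum_le_sum fun i hi => ?_
  have hi' : i ≤ k := Nat.lt_succ_iff.1 (mem_range.1 hi)
  have hk : k + 1 = (i + 1) + (k - i) := by omega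
  have hp := pow_sub_mul_pow_sub_nonneg hx hy (i + 1) (k - i)
  rw [hk, pow_add x (i + 1), pow_add y (i + 1)]
  linarith

/-- The power of the mean is at most the mean of the monomials of the same degree. -/
theorem pow_mean_le_completeHom (k : ℕ) {x y : ℝ} (hx : 0 ≤ x) (hy : 0 ≤ y) :
    ((x + y) / 2) ^ k ≤ completeHom k x y / (k + 1) := by
  induction k with
  | zero => simp [completeHom]
  | succ k ih =>
    -- Adding both recursions gives 2h_{k+1} = (x+y)h_k + x^(k+1) + y^(k+1), which is at least
    -- (x+y)h_k(k+2)/(k+1).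
    have h1 := completeHom_succ_left k x y
    have h2 := completeHom_succ_left k y x
    rw [← completeHom_comm k x y, ← completeHom_comm (k + 1) x y] at h2
    have h3 := add_mul_completeHom_le k hx hy
    have hm : 0 ≤ (x + y) / 2 := by positivity
    have h4 := mul_le_mul_of_nonneg_left ih hm
    rw [← pow_succ'] at h4
    refine h4.trans ?_
    push_cast
    rw [← mul_div_assoc, div_le_div_iff₀ (by positivity) (by positivity)]
    nlinarith

/-- Degrees 0 and 1 give equality in the mean inequality; degree 2 is the first with a surplus, and
the commutator term originates here. -/
theorem completeHom_two (x y : ℝ) :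
    completeHom 2 x y / (2 + 1) = ((x + y) / 2) ^ 2 + (x - y) ^ 2 / 12 := by
  simp [completeHom, sum_range_succ]
  ring

theorem geom_sum_add_le_sum_completeHom {N : ℕ} (hN : 3 ≤ N) {x y : ℝ} (hx : 0 ≤ x) (hy : 0 ≤ y) :
    ∑ k ∈ range N, ((x + y) / 2) ^ k + (x - y) ^ 2 / 12
      ≤ ∑ k ∈ range N, completeHom k x y / (k + 1) := by
  have h2 : 2 ∈ range N := mem_range.2 (by omega)
  rw [← add_sum_erase _ _ h2, ← add_sum_erase (range N) (fun k => completeHom k x y / (k + 1)) h2]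
  have h := sum_le_sum fun k (_ : k ∈ (range N).erase 2) => pow_mean_le_completeHom k hx hy
  have h3 := completeHom_two x y
  push_cast
  linarith

theorem one_sub_mul_pow_le {m : ℝ} (h0 : 0 ≤ m) (h1 : m ≤ 1) (N : ℕ) :
    (1 - m) * m ^ N ≤ 1 / (N + 1) := by
  rw [le_div_iff₀ (by positivity)]
  have hg := mul_neg_geom_sum m (N + 1)
  have hs : (N + 1 : ℝ) * m ^ N ≤ ∑ i ∈ range (N + 1), m ^ i := by
    have := card_nsmul_le_sum (range (N + 1)) (fun i => m ^ i) (m ^ N) fun i hi =>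
      pow_le_pow_of_le_one h0 h1 (Nat.lt_succ_iff.1 (mem_range.1 hi))
    simpa using this
  have hp : 0 ≤ m ^ (N + 1) := by positivity
  nlinarith [mul_le_mul_of_nonneg_left hs (sub_nonneg.2 h1)]

/-- Lower bound for the coefficients of the second derivative of the truncated entropy. -/
theorem sub_le_mul_sum_completeHom {N : ℕ} (hN : 3 ≤ N) {l m d C : ℝ} (hl : l ∈ Set.Icc (0 : ℝ) 1)
    (hm : m ∈ Set.Icc (0 : ℝ) 1) (hd : 0 ≤ d) (hC : 0 ≤ C) (hdC : d ≤ C * (l * m)) :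
    2 / (l + m) * d + d * (l - m) ^ 2 / 12 - C / (N + 1)
      ≤ d * ∑ k ∈ range N, completeHom k (1 - l) (1 - m) / (k + 1) := by
  obtain ⟨hl0, hl1⟩ := hl
  obtain ⟨hm0, hm1⟩ := hm
  have h := geom_sum_add_le_sum_completeHom hN (sub_nonneg.2 hl1) (sub_nonneg.2 hm1)
  rw [show (1 - l - (1 - m)) ^ 2 = (l - m) ^ 2 by ring] at h
  have h' := mul_le_mul_of_nonneg_left h hd
  refine le_trans ?_ h'
  -- With this r, l + m = 2(1 - r), so the full geometric series in r is 2/(l + m).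
  set r := (1 - l + (1 - m)) / 2 with hr
  have hr0 : 0 ≤ r := by rw [hr]; linarith
  have hr1 : r ≤ 1 := by rw [hr]; linarith
  have hlm : l + m = 2 * (1 - r) := by rw [hr]; ring
  have hmain : 2 / (l + m) * d - C / (N + 1) ≤ d * ∑ k ∈ range N, r ^ k := by
    rcases hr1.eq_or_lt with h1 | h1
    · have : l + m = 0 := by rw [hlm, h1]; ring
      rw [this, div_zero, zero_mul, zero_sub]
      have h5 : 0 ≤ C / (N + 1) := by positivity
      have h6 : 0 ≤ d * ∑ k ∈ range N, r ^ k := by positivity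
      linarith
    · have h1' : 0 < 1 - r := sub_pos.2 h1
      have hsum : ∑ k ∈ range N, r ^ k = 1 / (1 - r) - r ^ N / (1 - r) := by
        rw [eq_sub_iff_add_eq, ← eq_sub_iff_add_eq, ← sub_div, eq_div_iff h1'.ne', mul_comm]
        exact mul_neg_geom_sum r N
      have hpow := one_sub_mul_pow_le hr0 hr1 N
      -- By this AM–GM bound the hypothesis on d cancels the pole of the tail r^N/(1 - r), leaving
      -- (1 - r)r^N ≤ 1/(N + 1) uniformly in r.
      have hlm2 : l * m ≤ (1 - r) ^ 2 := by
        have : 1 - r = (l + m) / 2 := by rw [hlm]; ring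
        rw [this]
        nlinarith [sq_nonneg (l - m)]
      have herr : d * (r ^ N / (1 - r)) ≤ C / (N + 1) := by
        calc d * (r ^ N / (1 - r)) ≤ C * (1 - r) ^ 2 * (r ^ N / (1 - r)) := by
              refine mul_le_mul_of_nonneg_right (hdC.trans ?_) (by positivity)
              exact mul_le_mul_of_nonneg_left hlm2 hC
          _ = C * ((1 - r) * r ^ N) := by field_simp
          _ ≤ C * (1 / (N + 1)) := mul_le_mul_of_nonneg_left hpow hC
          _ = C / (N + 1) := by ring
      rw [hsum, mul_sub, hlm]
      have : 2 / (2 * (1 - r)) * d = d * (1 / (1 - r)) := by field_simp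
      linarith
  linarith

/-- Truncation of the expansion of `-x ln x` in powers of `1 - x`. -/
noncomputable def negMulLogApprox (N : ℕ) (x : ℝ) : ℝ :=
  ∑ k ∈ range N, x * (1 - x) ^ (k + 1) / (k + 1)

/-- This is the logarithm series in 1 - x; the factor x makes every term vanish at 0, where that
series diverges. -/
theorem tendsto_negMulLogApprox {x : ℝ} (hx : x ∈ Set.Icc (0 : ℝ) 1) :
    Filter.Tendsto (fun N => negMulLogApprox N x) Filter.atTop (nhds (Real.negMulLog x)) := by
  rcases hx.1.eq_or_lt with rfl | h0
  · simp [negMulLogApprox]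
  · have habs : |1 - x| < 1 := by rw [abs_lt]; constructor <;> linarith [hx.2]
    have h := ((Real.hasSum_pow_div_log_of_abs_lt_one habs).mul_left x).tendsto_sum_nat
    rw [show 1 - (1 - x) = x by ring] at h
    simp only [negMulLogApprox, mul_div_assoc, Real.negMulLog]
    convert h using 2
    ring

end Scalar

/-! ### Polynomial truncations of the von Neumann entropy -/

section EntropyApprox

open Finset

variable {n : Type*} [Fintype n]

theorem trace_basisMeasurement (v : OrthonormalBasis n ℂ (EuclideanSpace ℂ n)) (b : n) :
    (basisMeasurement v b).trace = 1 := by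
  have h := v.inner_eq_one b
  rw [basisMeasurement, Matrix.trace_vecMulVec]
  rwa [EuclideanSpace.inner_eq_star_dotProduct] at h

variable [DecidableEq n]

theorem re_trace_eq_sum (v : OrthonormalBasis n ℂ (EuclideanSpace ℂ n)) (A : Matrix n n ℂ) :
    A.trace.re = ∑ b, (A * basisMeasurement v b).trace.re := by
  rw [← Complex.re_sum, ← Matrix.trace_sum, ← mul_sum, (isPOVM_basisMeasurement v).sum_eq_one,
    Matrix.mul_one]

/-- Truncation of the expansion of the von Neumann entropy in powers of `1 - ρ`. -/
noncomputable def entropyApprox (N : ℕ) (ρ : Matrix n n ℂ) : ℝ :=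
  ∑ k ∈ range N, (ρ * (1 - ρ) ^ (k + 1)).trace.re / (k + 1)

theorem entropyApprox_eq_sum {ρ : Matrix n n ℂ} {v : OrthonormalBasis n ℂ (EuclideanSpace ℂ n)}
    {d : n → ℝ} (h : ∀ b, ρ *ᵥ (v b).ofLp = (d b : ℂ) • (v b).ofLp) (N : ℕ) :
    entropyApprox N ρ = ∑ b, negMulLogApprox N (d b) := by
  have hpow : ∀ k b, (1 - ρ) ^ k * basisMeasurement v b
      = (((1 - d b) ^ k : ℝ) : ℂ) • basisMeasurement v b := by
    intro k b
    induction k with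
    | zero => simp
    | succ k ih =>
      rw [pow_succ, Matrix.mul_assoc, Matrix.sub_mul, Matrix.one_mul, mul_basisMeasurement (h b),
        Matrix.mul_sub, Matrix.mul_smul, ih, pow_succ, smul_smul, ← sub_smul]
      congr 1
      push_cast
      ring
  simp only [negMulLogApprox, entropyApprox]
  rw [sum_comm]
  refine sum_congr rfl fun k _ => ?_
  rw [← sum_div]
  congr 1
  rw [re_trace_eq_sum v]
  refine sum_congr rfl fun b _ => ?_
  rw [Matrix.mul_assoc, hpow, Matrix.mul_smul, mul_basisMeasurement (h b), smul_smul,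
    Matrix.trace_smul, trace_basisMeasurement, smul_eq_mul, mul_one, ← Complex.ofReal_mul,
    Complex.ofReal_re, mul_comm]

theorem eigenvalues_mem_Icc {ρ : Matrix n n ℂ} (hρ : ρ.PosSemidef) (h1 : ρ.trace = 1) (b : n) :
    hρ.isHermitian.eigenvalues b ∈ Set.Icc (0 : ℝ) 1 := by
  refine ⟨hρ.eigenvalues_nonneg b, ?_⟩
  have h : ∑ b, hρ.isHermitian.eigenvalues b = 1 := by
    have := hρ.isHermitian.trace_eq_sum_eigenvalues
    rw [h1] at this
    simpa using (congrArg Complex.re this).symm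
  rw [← h]
  exact single_le_sum (fun b _ => hρ.eigenvalues_nonneg b) (mem_univ b)

theorem mulVec_eigenvectorBasis_ofReal {ρ : Matrix n n ℂ} (hρ : ρ.IsHermitian) (b : n) :
    ρ *ᵥ (hρ.eigenvectorBasis b).ofLp
      = (hρ.eigenvalues b : ℂ) • (hρ.eigenvectorBasis b).ofLp :=
  hρ.mulVec_eigenvectorBasis b

theorem tendsto_entropyApprox {ρ : Matrix n n ℂ} (hρ : ρ.PosSemidef) (h1 : ρ.trace = 1) :
    Filter.Tendsto (fun N => entropyApprox N ρ) Filter.atTop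
      (nhds (vonNeumannEntropy hρ.isHermitian)) := by
  simp only [entropyApprox_eq_sum (mulVec_eigenvectorBasis_ofReal hρ.isHermitian)]
  exact tendsto_finsetSum _ fun b _ => tendsto_negMulLogApprox (eigenvalues_mem_Icc hρ h1 b)

/-- The von Neumann entropy can be computed in any orthonormal eigenbasis. -/
theorem vonNeumannEntropy_eq_sum {ρ : Matrix n n ℂ} (hρ : ρ.PosSemidef) (h1 : ρ.trace = 1)
    {v : OrthonormalBasis n ℂ (EuclideanSpace ℂ n)} {d : n → ℝ}
    (h : ∀ b, ρ *ᵥ (v b).ofLp = (d b : ℂ) • (v b).ofLp) (hd : ∀ b, d b ∈ Set.Icc (0 : ℝ) 1) :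
    vonNeumannEntropy hρ.isHermitian = ∑ b, Real.negMulLog (d b) := by
  -- Both sums are limits of the same truncations, which are traces and do not depend on a basis.
  refine tendsto_nhds_unique (tendsto_entropyApprox hρ h1) ?_
  simp only [entropyApprox_eq_sum h]
  exact tendsto_finsetSum _ fun b _ => tendsto_negMulLogApprox (hd b)

end EntropyApprox

/-! ### The commutator of the two states -/

section Commutator

variable {n : Type*} [Fintype n] (ρ₀ ρ₁ : DensityOperator n)

/-- The squared Hilbert–Schmidt norm of the commutator of the two states. -/
noncomputable def commutatorSq : ℝ :=
  ((ρ₀.op * ρ₁.op - ρ₁.op * ρ₀.op)ᴴ * (ρ₀.op * ρ₁.op - ρ₁.op * ρ₀.op)).trace.re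

theorem commutatorSq_nonneg : 0 ≤ commutatorSq ρ₀ ρ₁ :=
  (Complex.le_def.1 (Matrix.posSemidef_conjTranspose_mul_self _).trace_nonneg).1

/-- Independence of t turns the gain in curvature into a constant, hence the gap into a multiple of
t(1-t). -/
theorem commutator_mean_diff (t : ℝ) :
    mean ρ₀ ρ₁ t * diff ρ₀ ρ₁ - diff ρ₀ ρ₁ * mean ρ₀ ρ₁ t
      = ρ₀.op * ρ₁.op - ρ₁.op * ρ₀.op := by
  simp only [mean, diff, Matrix.add_mul, Matrix.mul_add, Matrix.sub_mul, Matrix.mul_sub,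
    Matrix.smul_mul, Matrix.mul_smul, smul_sub]
  push_cast
  simp only [sub_smul, one_smul]
  abel

theorem commute_of_commutatorSq_eq_zero (h : commutatorSq ρ₀ ρ₁ = 0) : Commute ρ₀.op ρ₁.op := by
  have h0 : (ρ₀.op * ρ₁.op - ρ₁.op * ρ₀.op)ᴴ * (ρ₀.op * ρ₁.op - ρ₁.op * ρ₀.op) = 0 := by
    refine (Matrix.posSemidef_conjTranspose_mul_self _).trace_eq_zero_iff.1 ?_
    refine Complex.ext h ?_
    exact (Complex.le_def.1 (Matrix.posSemidef_conjTranspose_mul_self _).trace_nonneg).2.symm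
  exact sub_eq_zero.1 (Matrix.conjTranspose_mul_self_eq_zero.1 h0)

end Commutator

/-! ### Two derivatives of the truncated entropy along t -/

section Derivatives

open Finset

variable {n : Type*} [Fintype n] [DecidableEq n]

section MatrixNorm

attribute [local instance] Matrix.linftyOpNormedRing Matrix.linftyOpNormedAlgebra

theorem hasDerivAt_matrix_pow {X : ℝ → Matrix n n ℂ} {X' : Matrix n n ℂ} {t : ℝ}
    (hX : HasDerivAt X X' t) (m : ℕ) :
    HasDerivAt (fun s => X s ^ m) (∑ i ∈ range m, X t ^ i * X' * X t ^ (m - 1 - i)) t := by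
  induction m with
  | zero =>
    simp only [pow_zero, range_zero, sum_empty]
    exact hasDerivAt_const t _
  | succ m ih =>
    simp only [pow_succ _ m]
    refine (ih.mul hX).congr_deriv ?_
    rw [sum_range_succ, sum_mul]
    congr 1
    · refine sum_congr rfl fun i hi => ?_
      have := mem_range.1 hi
      rw [Matrix.mul_assoc, ← pow_succ, show m - 1 - i + 1 = m + 1 - 1 - i by omega]
    · simp

theorem hasDerivAt_re_trace_pow_mul {X : ℝ → Matrix n n ℂ} {X' : Matrix n n ℂ} {t : ℝ}
    (hX : HasDerivAt X X' t) (m : ℕ) (B : Matrix n n ℂ) :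
    HasDerivAt (fun s => (X s ^ m * B).trace.re)
      (∑ i ∈ range m, (X t ^ i * X' * X t ^ (m - 1 - i) * B).trace.re) t := by
  let ℓ : Matrix n n ℂ →ₗ[ℝ] ℝ :=
    Complex.reLm ∘ₗ (Matrix.traceLinearMap n ℝ ℂ) ∘ₗ (LinearMap.mulRight ℝ B)
  have h := (LinearMap.toContinuousLinearMap ℓ).hasFDerivAt.comp_hasDerivAt t
    (hasDerivAt_matrix_pow hX m)
  refine h.congr_deriv ?_
  change ℓ _ = _
  rw [map_sum]
  rfl

variable (ρ₀ ρ₁ : DensityOperator n)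

theorem hasDerivAt_one_sub_mean (t : ℝ) :
    HasDerivAt (fun s => 1 - mean ρ₀ ρ₁ s) (-diff ρ₀ ρ₁) t := by
  have h : ∀ s, 1 - mean ρ₀ ρ₁ s = 1 - ρ₀.op - s • diff ρ₀ ρ₁ := by
    intro s
    rw [mean, diff, ← Complex.coe_smul s, smul_sub]
    push_cast
    rw [sub_smul, one_smul]
    abel
  simp only [h]
  have h2 := ((hasDerivAt_id t).smul_const (diff ρ₀ ρ₁)).const_sub (1 - ρ₀.op)
  refine h2.congr_deriv ?_
  rw [one_smul]

end MatrixNorm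

variable (ρ₀ ρ₁ : DensityOperator n)

/-- The function `t ↦ tr((1 - ρ(t))ᵏ Δ)`. -/
noncomputable def tracePowDiff (k : ℕ) (t : ℝ) : ℝ :=
  ((1 - mean ρ₀ ρ₁ t) ^ k * diff ρ₀ ρ₁).trace.re

theorem re_trace_pow_mul_diff (t : ℝ) (i j : ℕ) :
    ((1 - mean ρ₀ ρ₁ t) ^ i * diff ρ₀ ρ₁ * (1 - mean ρ₀ ρ₁ t) ^ j * diff ρ₀ ρ₁).trace.re
      = ∑ a, ∑ b, diffEntrySq ρ₀ ρ₁ t a b *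
        ((1 - (mean_isHermitian ρ₀ ρ₁ t).eigenvalues a) ^ i *
          (1 - (mean_isHermitian ρ₀ ρ₁ t).eigenvalues b) ^ j) := by
  set hρ := mean_isHermitian ρ₀ ρ₁ t
  have hX : ∀ k : ℕ, toEigen hρ ((1 - mean ρ₀ ρ₁ t) ^ k)
      = Matrix.diagonal fun a => (((1 - hρ.eigenvalues a) ^ k : ℝ) : ℂ) := by
    intro k
    rw [map_pow, map_sub, map_one, toEigen_self, ← Matrix.diagonal_one, Matrix.diagonal_sub,
      Matrix.diagonal_pow]
    congr 1
    ext a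
    simp
  rw [← trace_toEigen hρ, map_mul, map_mul, map_mul, hX, hX, Matrix.trace, Complex.re_sum]
  refine sum_congr rfl fun a _ => ?_
  rw [Matrix.diag_apply, Matrix.mul_apply, Complex.re_sum]
  refine sum_congr rfl fun b _ => ?_
  rw [Matrix.mul_diagonal, Matrix.diagonal_mul]
  rw [show ∀ p x q y : ℂ, p * x * q * y = x * y * (p * q) by intros; ring,
    toEigen_diff_mul_swap, ← Complex.ofReal_mul, ← Complex.ofReal_mul, Complex.ofReal_re]

/-- The noncommutative product rule places Δ between powers i and k - i of 1 - ρ; in the eigenbasis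
these sum to a complete homogeneous polynomial. -/
theorem hasDerivAt_tracePowDiff_succ (k : ℕ) (t : ℝ) :
    HasDerivAt (tracePowDiff ρ₀ ρ₁ (k + 1)) (-∑ a, ∑ b, diffEntrySq ρ₀ ρ₁ t a b *
      completeHom k (1 - (mean_isHermitian ρ₀ ρ₁ t).eigenvalues a)
        (1 - (mean_isHermitian ρ₀ ρ₁ t).eigenvalues b)) t := by
  refine (hasDerivAt_re_trace_pow_mul (hasDerivAt_one_sub_mean ρ₀ ρ₁ t) (k + 1)
    (diff ρ₀ ρ₁)).congr_deriv ?_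
  simp only [Matrix.mul_neg, Matrix.neg_mul, Matrix.trace_neg, Complex.neg_re, sum_neg_distrib,
    re_trace_pow_mul_diff, completeHom, mul_sum, Nat.add_sub_cancel]
  rw [sum_comm]
  congr 1
  refine sum_congr rfl fun a _ => ?_
  rw [sum_comm]

theorem hasDerivAt_re_trace_pow_succ (k : ℕ) (t : ℝ) :
    HasDerivAt (fun s => ((1 - mean ρ₀ ρ₁ s) ^ (k + 1)).trace.re)
      (-((k + 1) * tracePowDiff ρ₀ ρ₁ k t)) t := by
  have h := hasDerivAt_re_trace_pow_mul (hasDerivAt_one_sub_mean ρ₀ ρ₁ t) (k + 1) 1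
  simp only [Matrix.mul_one] at h
  refine h.congr_deriv ?_
  -- Under the trace all k + 1 terms of the product rule coincide by cyclicity.
  have hterm : ∀ i ∈ range (k + 1), ((1 - mean ρ₀ ρ₁ t) ^ i * -diff ρ₀ ρ₁ *
      (1 - mean ρ₀ ρ₁ t) ^ (k + 1 - 1 - i)).trace.re = -tracePowDiff ρ₀ ρ₁ k t := by
    intro i hi
    have := mem_range.1 hi
    rw [Matrix.mul_neg, Matrix.neg_mul, Matrix.trace_neg, Complex.neg_re, Matrix.trace_mul_comm,
      ← Matrix.mul_assoc, ← pow_add, show k + 1 - 1 - i + i = k by omega, tracePowDiff]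
  rw [sum_congr rfl hterm, sum_const, card_range, nsmul_eq_mul]
  push_cast
  ring

/-- The derivative of the truncated entropy. -/
noncomputable def entropyApproxDeriv (N : ℕ) (t : ℝ) : ℝ :=
  tracePowDiff ρ₀ ρ₁ N t - tracePowDiff ρ₀ ρ₁ 0 t
    + ∑ k ∈ range N, tracePowDiff ρ₀ ρ₁ (k + 1) t / (k + 1)

theorem hasDerivAt_entropyApprox (N : ℕ) (t : ℝ) :
    HasDerivAt (fun s => entropyApprox N (mean ρ₀ ρ₁ s)) (entropyApproxDeriv ρ₀ ρ₁ N t) t := by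
  -- After this split the k-th derivative term is T_{k+1} - T_k + T_{k+1}/(k+1) with T_k =
  -- tr((1-ρ)^k Δ), and the first difference telescopes.
  have hsplit : ∀ (s : ℝ) (k : ℕ), (mean ρ₀ ρ₁ s * (1 - mean ρ₀ ρ₁ s) ^ (k + 1)).trace.re
      = ((1 - mean ρ₀ ρ₁ s) ^ (k + 1)).trace.re - ((1 - mean ρ₀ ρ₁ s) ^ (k + 1 + 1)).trace.re := by
    intro s k
    rw [← Complex.sub_re, ← Matrix.trace_sub, pow_succ' _ (k + 1)]
    congr 2
    noncomm_ring
  simp only [entropyApprox, hsplit]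
  refine (HasDerivAt.fun_sum fun k _ => ((hasDerivAt_re_trace_pow_succ ρ₀ ρ₁ k t).sub
    (hasDerivAt_re_trace_pow_succ ρ₀ ρ₁ (k + 1) t)).div_const ((k : ℝ) + 1)).congr_deriv ?_
  rw [entropyApproxDeriv, ← sum_range_sub fun k => tracePowDiff ρ₀ ρ₁ k t, ← sum_add_distrib]
  refine sum_congr rfl fun k _ => ?_
  push_cast
  field_simp
  ring

/-- The second derivative of the truncated entropy. -/
noncomputable def entropyApproxDeriv2 (N : ℕ) (t : ℝ) : ℝ :=
  -∑ a, ∑ b, diffEntrySq ρ₀ ρ₁ t a b *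
    (completeHom N (1 - (mean_isHermitian ρ₀ ρ₁ t).eigenvalues a)
        (1 - (mean_isHermitian ρ₀ ρ₁ t).eigenvalues b)
      + ∑ k ∈ range (N + 1), completeHom k (1 - (mean_isHermitian ρ₀ ρ₁ t).eigenvalues a)
        (1 - (mean_isHermitian ρ₀ ρ₁ t).eigenvalues b) / (k + 1))

theorem hasDerivAt_entropyApproxDeriv (N : ℕ) (t : ℝ) :
    HasDerivAt (entropyApproxDeriv ρ₀ ρ₁ (N + 1)) (entropyApproxDeriv2 ρ₀ ρ₁ N t) t := by
  have h0 : HasDerivAt (tracePowDiff ρ₀ ρ₁ 0) 0 t := by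
    have : tracePowDiff ρ₀ ρ₁ 0 = fun _ => (diff ρ₀ ρ₁).trace.re := by
      ext
      simp [tracePowDiff]
    rw [this]
    exact hasDerivAt_const _ _
  have h := ((hasDerivAt_tracePowDiff_succ ρ₀ ρ₁ N t).sub h0).add
    (HasDerivAt.fun_sum (u := range (N + 1)) fun k _ =>
      (hasDerivAt_tracePowDiff_succ ρ₀ ρ₁ k t).div_const ((k : ℝ) + 1))
  refine h.congr_deriv ?_
  simp only [entropyApproxDeriv2, mul_add, sum_add_distrib, neg_div, sum_neg_distrib, sub_zero,
    neg_add]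
  congr 2
  simp only [sum_div, mul_sum]
  rw [sum_comm]
  refine sum_congr rfl fun a _ => ?_
  rw [sum_comm]
  refine sum_congr rfl fun b _ => sum_congr rfl fun k _ => ?_
  rw [mul_div_assoc]

theorem mean_eigenvalues_mem_Icc {t : ℝ} (ht : t ∈ Set.Icc (0 : ℝ) 1) (a : n) :
    (mean_isHermitian ρ₀ ρ₁ t).eigenvalues a ∈ Set.Icc (0 : ℝ) 1 :=
  eigenvalues_mem_Icc (mean_posSemidef ρ₀ ρ₁ ht) (mean_trace ρ₀ ρ₁ t) a

theorem entropyApproxDeriv2_nonpos (N : ℕ) {t : ℝ} (ht : t ∈ Set.Icc (0 : ℝ) 1) :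
    entropyApproxDeriv2 ρ₀ ρ₁ N t ≤ 0 := by
  have hx := fun a => sub_nonneg.2 (mean_eigenvalues_mem_Icc ρ₀ ρ₁ ht a).2
  refine neg_nonpos.2 (sum_nonneg fun a _ => sum_nonneg fun b _ =>
    mul_nonneg (diffEntrySq_nonneg ρ₀ ρ₁ t a b) (add_nonneg ?_ (sum_nonneg fun k _ => ?_)))
  · exact completeHom_nonneg _ (hx a) (hx b)
  · exact div_nonneg (completeHom_nonneg _ (hx a) (hx b)) (by positivity)

/-- In the eigenbasis of ρ the commutator [ρ, Δ] has entries (λ_a - λ_b)Δ_ab. -/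
theorem commutatorSq_eq_sum (t : ℝ) :
    commutatorSq ρ₀ ρ₁ = ∑ a, ∑ b, diffEntrySq ρ₀ ρ₁ t a b *
      ((mean_isHermitian ρ₀ ρ₁ t).eigenvalues a
        - (mean_isHermitian ρ₀ ρ₁ t).eigenvalues b) ^ 2 := by
  set hρ := mean_isHermitian ρ₀ ρ₁ t with hhρ
  have hK : ∀ a b, toEigen hρ (ρ₀.op * ρ₁.op - ρ₁.op * ρ₀.op) a b
      = ((hρ.eigenvalues a - hρ.eigenvalues b : ℝ) : ℂ) * toEigen hρ (diff ρ₀ ρ₁) a b := by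
    intro a b
    rw [← commutator_mean_diff ρ₀ ρ₁ t, map_sub, map_mul, map_mul, toEigen_self,
      Matrix.sub_apply, Matrix.diagonal_mul, Matrix.mul_diagonal]
    push_cast
    ring
  rw [commutatorSq, ← trace_toEigen hρ, map_mul, ← Matrix.star_eq_conjTranspose, map_star,
    Matrix.star_eq_conjTranspose, Matrix.trace, Complex.re_sum, sum_comm]
  refine sum_congr rfl fun b _ => ?_
  rw [Matrix.diag_apply, Matrix.mul_apply, Complex.re_sum]
  refine sum_congr rfl fun a _ => ?_
  rw [Matrix.conjTranspose_apply, Complex.star_def, mul_comm, Complex.mul_conj, Complex.ofReal_re,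
    Complex.normSq_eq_norm_sq, hK, norm_mul, mul_pow, Complex.norm_real, Real.norm_eq_abs, sq_abs,
    mul_comm, diffEntrySq]

/-- The truncated entropy is more concave than prescribed by the curvature, up to an error that
vanishes with growing order of the truncation. -/
theorem entropyApproxDeriv2_le {N : ℕ} (hN : 2 ≤ N) {t : ℝ} (ht : t ∈ Set.Ioo (0 : ℝ) 1) :
    entropyApproxDeriv2 ρ₀ ρ₁ N t ≤ curvature ρ₀ ρ₁ t - commutatorSq ρ₀ ρ₁ / 12
      + (Fintype.card n : ℝ) ^ 2 * (2 * (((1 - t) ^ 2)⁻¹ + (t ^ 2)⁻¹)) / (N + 2) := by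
  have ht' := Set.Ioo_subset_Icc_self ht
  set l := (mean_isHermitian ρ₀ ρ₁ t).eigenvalues with hl
  set C : ℝ := 2 * (((1 - t) ^ 2)⁻¹ + (t ^ 2)⁻¹) with hC
  have hC0 : 0 ≤ C := by positivity
  have hmem : ∀ a, l a ∈ Set.Icc (0 : ℝ) 1 := mean_eigenvalues_mem_Icc ρ₀ ρ₁ ht'
  have hterm : ∀ a b, 2 / (l a + l b) * diffEntrySq ρ₀ ρ₁ t a b
      + diffEntrySq ρ₀ ρ₁ t a b * (l a - l b) ^ 2 / 12 - C / (N + 2)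
      ≤ diffEntrySq ρ₀ ρ₁ t a b * (completeHom N (1 - l a) (1 - l b)
        + ∑ k ∈ range (N + 1), completeHom k (1 - l a) (1 - l b) / (k + 1)) := by
    intro a b
    -- Order N + 1 ≥ 3 ensures that the degree-two surplus is present.
    have h := sub_le_mul_sum_completeHom (N := N + 1) (by omega) (hmem a) (hmem b)
      (diffEntrySq_nonneg ρ₀ ρ₁ t a b) hC0 (diffEntrySq_le_mul ρ₀ ρ₁ ht a b)
    -- The boundary term left by the telescoping has the favourable sign and is discarded.
    have h2 := mul_nonneg (diffEntrySq_nonneg ρ₀ ρ₁ t a b)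
      (completeHom_nonneg N (sub_nonneg.2 (hmem a).2) (sub_nonneg.2 (hmem b).2))
    push_cast at h
    rw [add_assoc (N : ℝ), one_add_one_eq_two] at h
    rw [mul_add]
    linarith
  have hsum := sum_le_sum fun a (_ : a ∈ univ) => sum_le_sum fun b (_ : b ∈ univ) => hterm a b
  simp only [sum_add_distrib, sum_sub_distrib, sum_const, card_univ, nsmul_eq_mul, ← sum_div]
    at hsum
  rw [entropyApproxDeriv2, curvature_eq, commutatorSq_eq_sum ρ₀ ρ₁ t]
  simp only [← hl, mul_add, sum_add_distrib] at hsum ⊢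
  have : (Fintype.card n : ℝ) ^ 2 * C / (N + 2)
    = Fintype.card n * (Fintype.card n * (C / (N + 2))) := by ring
  linarith

end Derivatives

/-! ### Common eigenbases and entropies of commuting states -/

section JointEigenbasis

open Module.End

variable {n : Type*} [Fintype n] [DecidableEq n]

/-- Commuting symmetric operators have a common orthonormal eigenbasis. -/
theorem exists_orthonormalBasis_mem_eigenspace {E : Type*} [NormedAddCommGroup E]
    [InnerProductSpace ℂ E] [FiniteDimensional ℂ E] {A B : E →ₗ[ℂ] E} (hA : A.IsSymmetric)
    (hB : B.IsSymmetric) (h : Commute A B) {m : ℕ} (hm : Module.finrank ℂ E = m) :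
    ∃ w : OrthonormalBasis (Fin m) ℂ E,
      ∀ b, ∃ i : ℂ × ℂ, w b ∈ eigenspace A i.2 ⊓ eigenspace B i.1 := by
  classical
  have hort := LinearMap.IsSymmetric.orthogonalFamily_eigenspace_inf_eigenspace hA hB
  have hint := DirectSum.isInternal_ne_bot_iff.2
    (LinearMap.IsSymmetric.directSum_isInternal_of_commute hA hB h)
  have hfin : Finite {i : ℂ × ℂ // eigenspace A i.2 ⊓ eigenspace B i.1 ≠ ⊥} :=
    WellFoundedGT.finite_ne_bot_of_iSupIndep hort.independent
  let _ := Fintype.ofFinite {i : ℂ × ℂ // eigenspace A i.2 ⊓ eigenspace B i.1 ≠ ⊥}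
  have hort' := hort.comp (Subtype.val_injective
    (p := fun i : ℂ × ℂ => eigenspace A i.2 ⊓ eigenspace B i.1 ≠ ⊥))
  exact ⟨hint.subordinateOrthonormalBasis hm hort', fun b =>
    ⟨_, hint.subordinateOrthonormalBasis_subordinate hm b hort'⟩⟩

/-- Commuting Hermitian matrices have a common orthonormal eigenbasis. -/
theorem exists_joint_eigenbasis {A B : Matrix n n ℂ} (hA : A.IsHermitian) (hB : B.IsHermitian)
    (h : Commute A B) : ∃ v : OrthonormalBasis n ℂ (EuclideanSpace ℂ n),
      IsEigenbasis v A ∧ IsEigenbasis v B := by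
  have hAB : Commute A.toEuclideanLin B.toEuclideanLin := by
    ext1 x
    have := congrArg (fun M => M *ᵥ x.ofLp) h.eq
    simp only [← Matrix.mulVec_mulVec] at this
    simp [Module.End.mul_apply, Matrix.toLpLin_apply, this]
  obtain ⟨w, hw⟩ := exists_orthonormalBasis_mem_eigenspace
    (Matrix.isSymmetric_toEuclideanLin_iff.mpr hA) (Matrix.isSymmetric_toEuclideanLin_iff.mpr hB)
    hAB finrank_euclideanSpace
  choose i hi using hw
  refine ⟨w.reindex (Fintype.equivFin n).symm, fun b => ⟨(i (Fintype.equivFin n b)).2, ?_⟩,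
    fun b => ⟨(i (Fintype.equivFin n b)).1, ?_⟩⟩
  all_goals rw [OrthonormalBasis.reindex_apply, Equiv.symm_symm]
  · exact congrArg WithLp.ofLp (mem_eigenspace_iff.1 (hi _).1)
  · exact congrArg WithLp.ofLp (mem_eigenspace_iff.1 (hi _).2)

/-- In an eigenbasis of the state, the Shannon information of the measurement is the von Neumann
entropy. -/
theorem vonNeumannEntropy_eq_shannon {ρ : Matrix n n ℂ} (hρ : ρ.PosSemidef) (h1 : ρ.trace = 1)
    {v : OrthonormalBasis n ℂ (EuclideanSpace ℂ n)} (hv : IsEigenbasis v ρ) :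
    vonNeumannEntropy hρ.isHermitian = shannon fun b => prob ρ (basisMeasurement v b) := by
  have hP := isPOVM_basisMeasurement v
  have hnn : ∀ b, 0 ≤ prob ρ (basisMeasurement v b) := fun b => prob_nonneg hρ (hP.posSemidef b)
  have hsum : ∑ b, prob ρ (basisMeasurement v b) = 1 := by
    simp only [prob]
    rw [← re_trace_eq_sum v, h1, Complex.one_re]
  refine vonNeumannEntropy_eq_sum hρ h1 (v := v) (fun b => ?_) fun b => ⟨hnn b, ?_⟩
  · obtain ⟨μ, hμ⟩ := hv b
    have htr : (ρ * basisMeasurement v b).trace = μ := by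
      rw [mul_basisMeasurement hμ, Matrix.trace_smul, trace_basisMeasurement, smul_eq_mul, mul_one]
    rw [hμ]
    congr 1
    rw [prob, htr]
    refine Complex.ext (Complex.ofReal_re _).symm ?_
    rw [← htr, trace_mul_im_eq_zero hρ.isHermitian (hP.posSemidef b).isHermitian,
      Complex.ofReal_im]
  · rw [← hsum]
    exact Finset.single_le_sum (fun b _ => hnn b) (Finset.mem_univ b)

end JointEigenbasis

/-! ### Comparison of L with the Holevo quantity, and the case of equality -/

section Holevo

open Filter Topology

variable {n : Type*} [Fintype n] [DecidableEq n] (ρ₀ ρ₁ : DensityOperator n)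

theorem mutualInfo_eq_holevo {v : OrthonormalBasis n ℂ (EuclideanSpace ℂ n)}
    (h₀ : IsEigenbasis v ρ₀.op) (h₁ : IsEigenbasis v ρ₁.op) {t : ℝ} (ht : t ∈ Set.Icc (0 : ℝ) 1) :
    mutualInfo ρ₀ ρ₁ (basisMeasurement v) t = holevo ρ₀ ρ₁ t := by
  have hm : IsEigenbasis v (mean ρ₀ ρ₁ t) := by
    intro b
    obtain ⟨α, hα⟩ := h₀ b
    obtain ⟨β, hβ⟩ := h₁ b
    refine ⟨((1 - t : ℝ) : ℂ) * α + (t : ℂ) * β, ?_⟩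
    rw [mean, Matrix.add_mulVec, Matrix.smul_mulVec, Matrix.smul_mulVec, hα, hβ, smul_smul,
      smul_smul, ← add_smul]
  rw [mutualInfo, holevo, vonNeumannEntropy_eq_shannon (mean_posSemidef ρ₀ ρ₁ ht)
    (mean_trace ρ₀ ρ₁ t) hm, vonNeumannEntropy_eq_shannon ρ₀.posSemidef ρ₀.trace_eq_one h₀,
    vonNeumannEntropy_eq_shannon ρ₁.posSemidef ρ₁.trace_eq_one h₁]

/-- The Holevo quantity with the entropies replaced by their truncations. -/
noncomputable def holevoApprox (N : ℕ) (t : ℝ) : ℝ :=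
  entropyApprox N (mean ρ₀ ρ₁ t) - (1 - t) * entropyApprox N ρ₀.op - t * entropyApprox N ρ₁.op

theorem tendsto_holevoApprox {t : ℝ} (ht : t ∈ Set.Icc (0 : ℝ) 1) :
    Tendsto (fun N => holevoApprox ρ₀ ρ₁ (N + 1) t) atTop (𝓝 (holevo ρ₀ ρ₁ t)) :=
  ((((tendsto_entropyApprox (mean_posSemidef ρ₀ ρ₁ ht) (mean_trace ρ₀ ρ₁ t)).sub
    ((tendsto_entropyApprox ρ₀.posSemidef ρ₀.trace_eq_one).const_mul (1 - t))).sub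
    ((tendsto_entropyApprox ρ₁.posSemidef ρ₁.trace_eq_one).const_mul t))).comp
    (tendsto_add_atTop_nat 1)

theorem hasDerivAt_holevoApprox (N : ℕ) (t : ℝ) :
    HasDerivAt (holevoApprox ρ₀ ρ₁ N) (entropyApproxDeriv ρ₀ ρ₁ N t
      + entropyApprox N ρ₀.op - entropyApprox N ρ₁.op) t := by
  have h := ((hasDerivAt_entropyApprox ρ₀ ρ₁ N t).sub (((hasDerivAt_id t).const_sub 1).mul_const
    (entropyApprox N ρ₀.op))).sub ((hasDerivAt_id t).mul_const (entropyApprox N ρ₁.op))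
  refine h.congr_deriv ?_
  ring

theorem continuous_holevoApprox (N : ℕ) : Continuous (holevoApprox ρ₀ ρ₁ N) :=
  continuous_iff_continuousAt.2 fun t => (hasDerivAt_holevoApprox ρ₀ ρ₁ N t).continuousAt

theorem hasDerivAt_holevoApproxDeriv (N : ℕ) (t : ℝ) :
    HasDerivAt (fun t => entropyApproxDeriv ρ₀ ρ₁ (N + 1) t
      + entropyApprox (N + 1) ρ₀.op - entropyApprox (N + 1) ρ₁.op)
      (entropyApproxDeriv2 ρ₀ ρ₁ N t) t :=
  ((hasDerivAt_entropyApproxDeriv ρ₀ ρ₁ N t).add_const _).sub_const _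

/-- Every truncation is concave in t with zero end values; nonnegativity passes to the limit. -/
theorem holevo_nonneg {t : ℝ} (ht : t ∈ Set.Icc (0 : ℝ) 1) : 0 ≤ holevo ρ₀ ρ₁ t := by
  refine ge_of_tendsto' (tendsto_holevoApprox ρ₀ ρ₁ ht) fun N => ?_
  refine nonneg_of_concaveOn_Icc (concaveOn_of_hasDerivAt2_nonpos
    (continuous_holevoApprox ρ₀ ρ₁ (N + 1)).continuousOn
    (fun s _ => hasDerivAt_holevoApprox ρ₀ ρ₁ (N + 1) s)
    (fun s _ => hasDerivAt_holevoApproxDeriv ρ₀ ρ₁ N s)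
    fun s hs => entropyApproxDeriv2_nonpos ρ₀ ρ₁ N (Set.Ioo_subset_Icc_self hs)) ?_ ?_ ht
  · simp [holevoApprox, mean]
  · simp [holevoApprox, mean]

variable {ρ₀ ρ₁} {L : ℝ → ℝ}

/-- On [a, 1-a] the truncation error is uniform, though not up to 0 and 1. A small multiple of s²/2
absorbs it, so F_N is concave and at least the minimum of its end values; then N → ∞. The function q
s(1-s)/24 spends the surplus q/12. -/
theorem IsCurvatureBound.min_le (hL : IsCurvatureBound ρ₀ ρ₁ L) {a t : ℝ} (ha : 0 < a)
    (ht : t ∈ Set.Icc a (1 - a)) :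
    min (holevo ρ₀ ρ₁ a - L a - commutatorSq ρ₀ ρ₁ / 24 * (a * (1 - a)))
      (holevo ρ₀ ρ₁ (1 - a) - L (1 - a) - commutatorSq ρ₀ ρ₁ / 24 * ((1 - a) * (1 - (1 - a))))
      ≤ holevo ρ₀ ρ₁ t - L t - commutatorSq ρ₀ ρ₁ / 24 * (t * (1 - t)) := by
  set q := commutatorSq ρ₀ ρ₁ with hq
  set K : ℝ := (Fintype.card n : ℝ) ^ 2 * (2 * ((a ^ 2)⁻¹ + (a ^ 2)⁻¹)) with hK
  have haa : a ≤ 1 - a := ht.1.trans ht.2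
  have hsub : Set.Icc a (1 - a) ⊆ Set.Ioo 0 1 := fun s hs =>
    ⟨ha.trans_le hs.1, by linarith [hs.2]⟩
  let F : ℕ → ℝ → ℝ := fun N s => holevoApprox ρ₀ ρ₁ (N + 1) s - L s - q / 24 * (s * (1 - s))
    - K / (N + 2) * (s ^ 2 / 2)
  have hconc : ∀ N, 2 ≤ N → ConcaveOn ℝ (Set.Icc a (1 - a)) (F N) := by
    intro N hN
    refine concaveOn_of_hasDerivAt2_nonpos
      (f' := fun s => (entropyApproxDeriv ρ₀ ρ₁ (N + 1) s + entropyApprox (N + 1) ρ₀.op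
        - entropyApprox (N + 1) ρ₁.op) - deriv L s - q / 24 * (1 - 2 * s) - K / (N + 2) * s)
      (f'' := fun s => entropyApproxDeriv2 ρ₀ ρ₁ N s - curvature ρ₀ ρ₁ s - q / 24 * (-2)
        - K / (N + 2)) ?_ ?_ ?_ ?_
    · have h1 := (continuous_holevoApprox ρ₀ ρ₁ (N + 1)).continuousOn (s := Set.Icc a (1 - a))
      have h2 := hL.continuousOn.mono (hsub.trans Set.Ioo_subset_Icc_self)
      exact ((h1.sub h2).sub (by fun_prop)).sub (by fun_prop)
    · intro s hs
      have hs' := hsub (Set.Ioo_subset_Icc_self hs)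
      have h1 : HasDerivAt (fun s : ℝ => q / 24 * (s * (1 - s))) (q / 24 * (1 - 2 * s)) s := by
        refine (((hasDerivAt_id s).mul ((hasDerivAt_id s).const_sub 1)).const_mul
          (q / 24)).congr_deriv ?_
        simp only [id]
        ring
      have h2 : HasDerivAt (fun s : ℝ => K / (N + 2) * (s ^ 2 / 2)) (K / (N + 2) * s) s := by
        refine (((hasDerivAt_pow 2 s).div_const 2).const_mul (K / (N + 2))).congr_deriv ?_
        simp
      exact (((hasDerivAt_holevoApprox ρ₀ ρ₁ (N + 1) s).sub
        (hL.differentiableAt s hs').hasDerivAt).sub h1).sub h2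
    · intro s hs
      have hs' := hsub (Set.Ioo_subset_Icc_self hs)
      have h1 : HasDerivAt (fun s : ℝ => q / 24 * (1 - 2 * s)) (q / 24 * (-2)) s := by
        refine ((((hasDerivAt_id s).const_mul 2).const_sub 1).const_mul (q / 24)).congr_deriv ?_
        ring
      have h2 : HasDerivAt (fun s : ℝ => K / (N + 2) * s) (K / (N + 2)) s := by
        refine ((hasDerivAt_id s).const_mul (K / (N + 2))).congr_deriv ?_
        ring
      exact (((hasDerivAt_holevoApproxDeriv ρ₀ ρ₁ N s).sub
        (hL.hasDerivAt_deriv s hs')).sub h1).sub h2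
    · intro s hs
      have hs' := hsub (Set.Ioo_subset_Icc_self hs)
      have h := entropyApproxDeriv2_le ρ₀ ρ₁ hN hs'
      have hKs : (Fintype.card n : ℝ) ^ 2 * (2 * (((1 - s) ^ 2)⁻¹ + (s ^ 2)⁻¹)) / (N + 2)
          ≤ K / (N + 2) := by
        have h1 : a ≤ s := hs.1.le
        have h2 : a ≤ 1 - s := by linarith [hs.2]
        rw [hK]
        gcongr
      linarith
  have hlim : ∀ s ∈ Set.Icc a (1 - a), Tendsto (fun N => F N s) atTop
      (𝓝 (holevo ρ₀ ρ₁ s - L s - q / 24 * (s * (1 - s)))) := by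
    intro s hs
    have h0 : Tendsto (fun N : ℕ => K / ((N : ℝ) + 2)) atTop (𝓝 0) :=
      tendsto_const_nhds.div_atTop (tendsto_atTop_add_const_right _ _ tendsto_natCast_atTop_atTop)
    have h1 := (((tendsto_holevoApprox ρ₀ ρ₁ (Set.Ioo_subset_Icc_self (hsub hs))).sub_const
      (L s)).sub_const (q / 24 * (s * (1 - s)))).sub (h0.mul_const (s ^ 2 / 2))
    simpa using h1
  have hl := Set.left_mem_Icc.2 haa
  have hr := Set.right_mem_Icc.2 haa
  refine le_of_tendsto_of_tendsto ((hlim a hl).min (hlim _ hr)) (hlim t ht) ?_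
  filter_upwards [eventually_ge_atTop 2] with N hN
  exact (hconc N hN).min_le_of_mem_Icc hl hr ht

/-- The gap between the Holevo quantity and the bound `L` is controlled by the commutator. -/
theorem IsCurvatureBound.add_commutatorSq_le_holevo (hL : IsCurvatureBound ρ₀ ρ₁ L) {t : ℝ}
    (ht : t ∈ Set.Ioo (0 : ℝ) 1) :
    L t + commutatorSq ρ₀ ρ₁ / 24 * (t * (1 - t)) ≤ holevo ρ₀ ρ₁ t := by
  set q := commutatorSq ρ₀ ρ₁ with hq
  -- The Holevo quantity at the cut points is replaced by its lower bound 0, so a → 0 needs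
  -- continuity of L only.
  let φ : ℝ → ℝ := fun a => min (0 - L a - q / 24 * (a * (1 - a)))
    (0 - L (1 - a) - q / 24 * ((1 - a) * (1 - (1 - a))))
  have hφc : ContinuousOn φ (Set.Icc 0 1) := by
    have h1 := hL.continuousOn
    have h2 : ContinuousOn (fun a => L (1 - a)) (Set.Icc 0 1) :=
      h1.comp (by fun_prop) fun a ha => ⟨by linarith [ha.2], by linarith [ha.1]⟩
    exact ContinuousOn.inf ((continuousOn_const.sub h1).sub (by fun_prop))
      ((continuousOn_const.sub h2).sub (by fun_prop))
  have hφ0 : φ 0 = 0 := by simp [φ, hL.zero, hL.one]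
  have hlim : Tendsto φ (𝓝[>] 0) (𝓝 0) := by
    have h := hφc 0 (by simp)
    rw [ContinuousWithinAt, hφ0] at h
    exact h.mono_left (nhdsWithin_le_of_mem (Icc_mem_nhdsGT zero_lt_one))
  have hle : 0 ≤ holevo ρ₀ ρ₁ t - L t - q / 24 * (t * (1 - t)) := by
    refine le_of_tendsto hlim ?_
    have hmin : 0 < min t (1 - t) := lt_min ht.1 (sub_pos.2 ht.2)
    filter_upwards [Ioo_mem_nhdsGT hmin] with a ha
    have hat := (lt_min_iff.1 ha.2)
    have hmem : t ∈ Set.Icc a (1 - a) := ⟨hat.1.le, by linarith [hat.2]⟩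
    refine le_trans ?_ (hL.min_le ha.1 hmem)
    have h1 := holevo_nonneg ρ₀ ρ₁ (t := a) ⟨ha.1.le, by linarith [hat.1, ht.2]⟩
    have h2 := holevo_nonneg ρ₀ ρ₁ (t := 1 - a) ⟨by linarith [hat.1, ht.2], by linarith [ha.1]⟩
    exact min_le_min (by linarith) (by linarith)
  linarith

theorem IsCurvatureBound.le_holevo (hL : IsCurvatureBound ρ₀ ρ₁ L) {t : ℝ}
    (ht : t ∈ Set.Icc (0 : ℝ) 1) : L t ≤ holevo ρ₀ ρ₁ t := by
  rcases ht.1.eq_or_lt with rfl | h0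
  · rw [hL.zero]
    exact holevo_nonneg ρ₀ ρ₁ ht
  rcases ht.2.eq_or_lt with rfl | h1
  · rw [hL.one]
    exact holevo_nonneg ρ₀ ρ₁ ht
  have h := hL.add_commutatorSq_le_holevo ⟨h0, h1⟩
  have := mul_nonneg (div_nonneg (commutatorSq_nonneg ρ₀ ρ₁) (by norm_num : (0 : ℝ) ≤ 24))
    (mul_nonneg h0.le (sub_nonneg.2 h1.le))
  linarith

theorem IsCurvatureBound.accessibleInfo_le (hL : IsCurvatureBound ρ₀ ρ₁ L) {t : ℝ}
    (ht : t ∈ Set.Icc (0 : ℝ) 1) : accessibleInfo ρ₀ ρ₁ t ≤ L t := by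
  obtain ⟨N, E, hE, h⟩ := (isGreatest_accessibleInfo ρ₀ ρ₁ t).1
  rw [← h]
  exact hL.mutualInfo_le hE ht

-- Since L lies between I and S, equality leaves no room for the commutator gap.
variable (ρ₀ ρ₁) in
theorem accessibleInfo_eq_holevo_iff {t : ℝ} (ht : t ∈ Set.Ioo (0 : ℝ) 1) :
    accessibleInfo ρ₀ ρ₁ t = holevo ρ₀ ρ₁ t ↔ Commute ρ₀.op ρ₁.op := by
  obtain ⟨L, hL⟩ := exists_isCurvatureBound ρ₀ ρ₁
  have ht' := Set.Ioo_subset_Icc_self ht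
  have hIL := hL.accessibleInfo_le ht'
  constructor
  · intro h
    have hLS := hL.add_commutatorSq_le_holevo ht
    have htt : 0 < t * (1 - t) := mul_pos ht.1 (sub_pos.2 ht.2)
    have hq := commutatorSq_nonneg ρ₀ ρ₁
    refine commute_of_commutatorSq_eq_zero ρ₀ ρ₁ (le_antisymm ?_ hq)
    by_contra hpos
    have := mul_pos (div_pos (not_le.1 hpos) (by norm_num : (0 : ℝ) < 24)) htt
    linarith
  · intro h
    obtain ⟨v, h₀, h₁⟩ := exists_joint_eigenbasis ρ₀.posSemidef.isHermitian
      ρ₁.posSemidef.isHermitian h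
    refine le_antisymm (hIL.trans (hL.le_holevo ht')) ?_
    rw [← mutualInfo_eq_holevo ρ₀ ρ₁ h₀ h₁ ht']
    exact (isGreatest_accessibleInfo ρ₀ ρ₁ t).2
      (mutualInfo_mem_values ρ₀ ρ₁ (isPOVM_basisMeasurement v) t)

end Holevo

end BinaryChannel

/-! ### The main theorem -/

theorem mainTheorem3 {n : Type*} [Fintype n] [DecidableEq n]
    (ρ₀ ρ₁ : BinaryChannel.DensityOperator n) :
    -- for `0 < t < 1`, the operator `𝓛_ρ(Δ)` is Hermitian and solves its defining equation
    (∀ t ∈ Set.Ioo (0 : ℝ) 1,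
      (BinaryChannel.loweredDiff ρ₀ ρ₁ t).IsHermitian ∧
      (1 / 2 : ℂ) • (BinaryChannel.mean ρ₀ ρ₁ t * BinaryChannel.loweredDiff ρ₀ ρ₁ t
        + BinaryChannel.loweredDiff ρ₀ ρ₁ t * BinaryChannel.mean ρ₀ ρ₁ t)
        = BinaryChannel.diff ρ₀ ρ₁) ∧
    -- the mutual information of every measurement is twice differentiable on `(0,1)`
    (∀ (N : ℕ) (E : Fin N → Matrix n n ℂ), BinaryChannel.IsPOVM E →
      ∀ t ∈ Set.Ioo (0 : ℝ) 1, ContDiffAt ℝ 2 (BinaryChannel.mutualInfo ρ₀ ρ₁ E) t) ∧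
    -- `-tr(Δ 𝓛_ρ(Δ))` is the minimum of `J''(t)` over all measurements
    (∀ t ∈ Set.Ioo (0 : ℝ) 1,
      IsLeast (BinaryChannel.mutualInfoSecondDerivValues ρ₀ ρ₁ t)
        (BinaryChannel.curvature ρ₀ ρ₁ t)) ∧
    -- and the minimum is attained by measuring in any eigenbasis of `𝓛_ρ(Δ)`
    (∀ t ∈ Set.Ioo (0 : ℝ) 1, ∀ v : OrthonormalBasis n ℂ (EuclideanSpace ℂ n),
      BinaryChannel.IsEigenbasis v (BinaryChannel.loweredDiff ρ₀ ρ₁ t) →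
      BinaryChannel.IsPOVM (BinaryChannel.basisMeasurement v) ∧
      ContDiffAt ℝ 2
        (BinaryChannel.mutualInfo ρ₀ ρ₁ (BinaryChannel.basisMeasurement v)) t ∧
      iteratedDeriv 2 (BinaryChannel.mutualInfo ρ₀ ρ₁ (BinaryChannel.basisMeasurement v)) t
        = BinaryChannel.curvature ρ₀ ρ₁ t) ∧
    -- the accessible information is a maximum
    (∀ t ∈ Set.Icc (0 : ℝ) 1,
      IsGreatest (BinaryChannel.mutualInfoValues ρ₀ ρ₁ t)
        (BinaryChannel.accessibleInfo ρ₀ ρ₁ t)) ∧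
    -- the function `L` exists, is unique on `[0,1]`, and satisfies `I ≤ L ≤ S`
    (∃ L : ℝ → ℝ, BinaryChannel.IsCurvatureBound ρ₀ ρ₁ L ∧
      (∀ L' : ℝ → ℝ, BinaryChannel.IsCurvatureBound ρ₀ ρ₁ L' → Set.EqOn L' L (Set.Icc 0 1)) ∧
      ∀ t ∈ Set.Icc (0 : ℝ) 1,
        BinaryChannel.accessibleInfo ρ₀ ρ₁ t ≤ L t ∧ L t ≤ BinaryChannel.holevo ρ₀ ρ₁ t) ∧
    -- equality in the Holevo bound
    (∀ t ∈ Set.Ioo (0 : ℝ) 1,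
      BinaryChannel.accessibleInfo ρ₀ ρ₁ t = BinaryChannel.holevo ρ₀ ρ₁ t ↔
        Commute ρ₀.op ρ₁.op) := by
  refine ⟨fun t ht => ⟨BinaryChannel.loweredDiff_isHermitian ρ₀ ρ₁ t, ?_⟩,
    fun N E hE t ht => BinaryChannel.contDiffAt_mutualInfo ρ₀ ρ₁ hE ht,
    fun t ht => BinaryChannel.isLeast_curvature ρ₀ ρ₁ ht,
    fun t ht v hv => ⟨BinaryChannel.isPOVM_basisMeasurement v,
      BinaryChannel.contDiffAt_mutualInfo ρ₀ ρ₁ (BinaryChannel.isPOVM_basisMeasurement v) ht,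
      BinaryChannel.iteratedDeriv_eigenbasis ρ₀ ρ₁ ht hv⟩,
    fun t _ => BinaryChannel.isGreatest_accessibleInfo ρ₀ ρ₁ t, ?_,
    fun t ht => BinaryChannel.accessibleInfo_eq_holevo_iff ρ₀ ρ₁ ht⟩
  · rw [BinaryChannel.mean_mul_loweredDiff_add ρ₀ ρ₁ ht, smul_smul]
    norm_num
  · obtain ⟨L, hL⟩ := BinaryChannel.exists_isCurvatureBound ρ₀ ρ₁
    exact ⟨L, hL, fun L' hL' t ht => le_antisymm (hL.le_of_le hL' ht) (hL'.le_of_le hL ht),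
      fun t ht => ⟨hL.accessibleInfo_le ht, hL.le_holevo ht⟩⟩
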